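/- Let $(X,Y)$ be a bivariate normal random vector with mean vector $(\mu_X,\mu_Y)\in\mathbb{R}^2$, variances $(\sigma_X^2,\sigma_Y^2)\in(0,\infty)^2$ and correlation coefficient $\rho\in(-1,1)$. Let $n\ge 1$ be an integer, let $Z_1,\ldots,Z_n$ be independent copies of $Z=XY$, and let $S_n=\sum_{i=1}^n Z_i$. Put $a_{j,k}(x)=k-j$ if $x\ge 0$ and $a_{j,k}(x)=j$ if $x<0$, and let $\mathrm{sgn}(x)$ be $1$, $0$, $-1$ for $x>0$, $x=0$, $x<0$ respectively. Let $U$ denote the Tricomi confluent hypergeometric function, $$U(a,b,x)=\frac{\Gamma(b-1)}{\Gamma(a)}x^{1-b}{}_1F_1(a-b+1;2-b;x)+\frac{\Gamma(1-b)}{\Gamma(a-b+1)}{}_1F_1(a;b;x)\quad(b\notin\mathbb{Z}),\qquad U(a,b,x)=\lim_{\beta\to b}U(a,\beta,x)\quad(b\in\mathbb{Z}),$$ where ${}_1F_1(a;b;x)=\sum_{j\ge0}\frac{(a)_j}{(b)_j}\frac{x^j}{j!}$, $(u)_j=u(u+1)\cdots(u+j-1)$, and $1/\Gamma$ is taken to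 be $0$ at the poles of $\Gamma$. Then $S_n$ has a probability density function $f_{S_n}$ which, for all $x\in\mathbb{R}$ (with $x\neq 0$ if $n=1$), is given by the convergent double series $$\begin{aligned} f_{S_n}(x)&=\frac{(1-\rho^2)^{n/2-1}}{2^{n-1}\sigma_X\sigma_Y}\exp\bigg(-\frac{n}{2(1-\rho^2)}\bigg(\frac{\mu_X^2}{\sigma_X^2}+\frac{\mu_Y^2}{\sigma_Y^2}-\frac{2\rho\mu_X\mu_Y}{\sigma_X\sigma_Y}\bigg)-\frac{|x|}{\sigma_X\sigma_Y(1+\rho\,\mathrm{sgn}(x))}\bigg)\\ &\quad\times\sum_{k=0}^\infty\sum_{j=0}^k\frac{(n/8)^k}{k!\,\Gamma(n/2+a_{j,k}(x))}\binom{k}{j}\bigg(\frac{1+\rho}{1-\rho}\bigg)^j\bigg(\frac{\mu_X}{\sigma_X}-\frac{\mu_Y}{\sigma_Y}\bigg)^{2j}\bigg(\frac{1-\rho}{1+\rho}\bigg)^{k-j}\\ &\quad\times\bigg(\frac{\mu_X}{\sigma_X}+\frac{\mu_Y}{\sigma_Y}\bigg)^{2k-2j}U\bigg(1-\frac n2-a_{j,k}(x),\,2-n-k,\,\frac{2|x|}{\sigma_X\sigma_Y(1-\rho^2)}\bigg).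 \end{aligned}$$ Moreover, this is the nonnegative version of the density that is continuous on $\mathbb{R}$ if $n\ge2$, and on $\mathbb{R}\setminus\{0\}$ if $n=1$ (here $0^0=1$). -/

import Mathlib

open MeasureTheory ProbabilityTheory Filter Topology

noncomputable section

/-- The confluent hypergeometric series `₁F₁(a; b; x) = ∑ⱼ (a)ⱼ / (b)ⱼ * xʲ / j!`
(for `b` not a nonpositive integer), with `(u)ⱼ = u (u + 1) ⋯ (u + j - 1)`. -/
def hyp1F1 (a b x : ℝ) : ℝ :=
  ∑' j : ℕ, (ascPochhammer ℝ j).eval a / (ascPochhammer ℝ j).eval b * (x ^ j / (j.factorial : ℝ))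

/-- The formula for Tricomi's function `U(a, b, x)` with non-integer `b`:
`Γ(b-1)/Γ(a) * x^(1-b) * ₁F₁(a-b+1; 2-b; x) + Γ(1-b)/Γ(a-b+1) * ₁F₁(a; b; x)`.
Mathlib's `Real.Gamma` vanishes at its poles, so that `c / Real.Gamma s = 0` there, which agrees
with the usual convention `1 / Γ(s) = 0`. -/
def tricomiUNonint (a b x : ℝ) : ℝ :=
  Real.Gamma (b - 1) / Real.Gamma a * x ^ (1 - b) * hyp1F1 (a - b + 1) (2 - b) x
    + Real.Gamma (1 - b) / Real.Gamma (a - b + 1) * hyp1F1 a b x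

open scoped Classical in
/-- Tricomi's confluent hypergeometric function of the second kind `U(a, b, x)`: the explicit
formula if `b` is not an integer, and its limit as `β → b` if `b` is an integer. -/
def tricomiU (a b x : ℝ) : ℝ :=
  if ∃ m : ℤ, (m : ℝ) = b then limUnder (𝓝[≠] b) (fun β : ℝ => tricomiUNonint a β x)
  else tricomiUNonint a b x

/-- The bivariate normal distribution with mean `(μX, μY)`, variances `(σX², σY²)` and correlation
coefficient `ρ`. -/
def bivariateNormal (μX μY σX σY ρ : ℝ) : Measure (EuclideanSpace ℝ (Fin 2)) :=
  multivariateGaussian !₂[μX, μY] !![σX ^ 2, ρ * σX * σY; ρ * σX * σY, σY ^ 2]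

/-- `a_{j,k}(x)`, equal to `k - j` if `x ≥ 0` and to `j` if `x < 0`. -/
def aIdx (j k : ℕ) (x : ℝ) : ℝ := if 0 ≤ x then (k : ℝ) - j else j

/-- The `(k, j)`-th term of the double series. -/
def seriesTerm (n : ℕ) (μX μY σX σY ρ x : ℝ) (k j : ℕ) : ℝ :=
  ((n : ℝ) / 8) ^ k / ((k.factorial : ℝ) * Real.Gamma ((n : ℝ) / 2 + aIdx j k x))
    * (k.choose j : ℝ)
    * ((1 + ρ) / (1 - ρ)) ^ j * (μX / σX - μY / σY) ^ (2 * j)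
    * ((1 - ρ) / (1 + ρ)) ^ (k - j) * (μX / σX + μY / σY) ^ (2 * k - 2 * j)
    * tricomiU (1 - (n : ℝ) / 2 - aIdx j k x) (2 - (n : ℝ) - k)
        (2 * |x| / (σX * σY * (1 - ρ ^ 2)))

/-- The factor in front of the double series. -/
def seriesPrefactor (n : ℕ) (μX μY σX σY ρ x : ℝ) : ℝ :=
  (1 - ρ ^ 2) ^ ((n : ℝ) / 2 - 1) / ((2 : ℝ) ^ ((n : ℝ) - 1) * σX * σY)
    * Real.exp
        (-((n : ℝ) / (2 * (1 - ρ ^ 2)))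
            * (μX ^ 2 / σX ^ 2 + μY ^ 2 / σY ^ 2 - 2 * ρ * μX * μY / (σX * σY))
          - |x| / (σX * σY * (1 + ρ * Real.sign x)))

/-- The double series formula, as a function of `x`. -/
def seriesDensity (n : ℕ) (μX μY σX σY ρ x : ℝ) : ℝ :=
  seriesPrefactor n μX μY σX σY ρ x
    * ∑' k : ℕ, ∑ j ∈ Finset.range (k + 1), seriesTerm n μX μY σX σY ρ x k j

end

/-! Put A = X/σX + Y/σY and B = X/σX - Y/σY. These are independent normals with variances 2(1+ρ) and
2(1-ρ), and XY = σXσY(A² - B²)/4. Hence the sum of n copies is distributed as the difference of two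
independent scaled noncentral chi-square variables. Each of these is a Poisson mixture of gamma laws
with shapes n/2 + i and a fixed rate 1/(σXσY(1±ρ)). The equality of laws (`map_sum_eq_withDensity`)
is proved by comparing moment generating functions near 0, which suffices by `ext_of_lintegralExp`.

The density of a difference of two independent gamma variables is, for x > 0, an exponential times
∫₀^∞ t^(β-1) (x+t)^(α-1) e^(-ct) dt, and the case x < 0 follows by exchanging the two variables
(`diffDensity_gammaPDF`). Summing over both Poisson indices, grouped by their total k, gives the
double series (`diffDensity_gammaMixture`, `seriesPrefactor_mul_seriesTerm`).

The integral must still be recognised as Tricomi's function, which is defined here by Kummer series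
and, at integer parameters, by a limit. For 0 < q < 1 the integral and the combination of Kummer
series solve the same differential equation with the same behaviour at 0, so a Wronskian argument
identifies them. Contiguous relations carry this to all non-integer q > 0, and continuity of the
integral in its exponent yields the integer case (`tricomiU_eq`).

Continuity rests on a bound uniform in x: the density of a gamma difference is at most the sum of
the rates once one shape is at least 1 (`diffGamma_le`), which covers every term with k ≥ 1. -/

/-! ### The integral `∫₀^∞ t^(p-1) (a+t)^γ e^(-ct) dt` -/

/-- The integral `∫₀^∞ t^(p-1) (a+t)^γ e^(-ct) dt`. -/
noncomputable def shiftedGamma (p γ c a : ℝ) : ℝ :=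
  ∫ t in Set.Ioi (0 : ℝ), t ^ (p - 1) * (a + t) ^ γ * Real.exp (-(c * t))

/-- The alternative in `h` recurs below: a negative power needs a positive shift, while a
nonnegative power tolerates shift 0. It becomes the distinction between x ≠ 0 and x = 0 for the
density. -/
lemma exists_rpow_le_mul_exp {δ γ ε : ℝ} (hε : 0 < ε) (h : 0 < δ ∨ (0 ≤ γ ∧ 0 ≤ δ)) :
    ∃ C, 0 ≤ C ∧ ∀ u, δ ≤ u → u ^ γ ≤ C * Real.exp (ε * u) := by
  have hδ : 0 ≤ δ := h.elim le_of_lt And.right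
  rcases lt_trichotomy γ 0 with hγ | rfl | hγ
  · have hδ' : 0 < δ := h.resolve_right fun h => absurd h.1 (not_le.2 hγ)
    refine ⟨δ ^ γ, by positivity, fun u hu => ?_⟩
    have h1 : u ^ γ ≤ δ ^ γ := Real.rpow_le_rpow_of_nonpos hδ' hu hγ.le
    have h2 : 1 ≤ Real.exp (ε * u) := Real.one_le_exp (mul_nonneg hε.le (hδ.trans hu))
    exact h1.trans (le_mul_of_one_le_right (by positivity) h2)
  · refine ⟨1, zero_le_one, fun u hu => ?_⟩
    rw [Real.rpow_zero, one_mul]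
    exact Real.one_le_exp (mul_nonneg hε.le (hδ.trans hu))
  -- The constant comes from raising s ≤ exp s, with s = εu/γ, to the power γ.
  · refine ⟨(γ / ε) ^ γ, by positivity, fun u hu => ?_⟩
    have hu0 : 0 ≤ u := hδ.trans hu
    have h1 : u ≤ γ / ε * Real.exp (ε * u / γ) := by
      have := Real.add_one_le_exp (ε * u / γ)
      calc u = γ / ε * (ε * u / γ) := by field_simp
        _ ≤ γ / ε * Real.exp (ε * u / γ) := by gcongr; linarith
    calc u ^ γ ≤ (γ / ε * Real.exp (ε * u / γ)) ^ γ := Real.rpow_le_rpow hu0 h1 hγ.le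
      _ = (γ / ε) ^ γ * Real.exp (ε * u) := by
        rw [Real.mul_rpow (by positivity) (Real.exp_pos _).le, ← Real.exp_mul]
        congr 2; field_simp

lemma integrableOn_rpow_mul_exp_neg {p c : ℝ} (hp : 0 < p) (hc : 0 < c) :
    IntegrableOn (fun t : ℝ => t ^ (p - 1) * Real.exp (-(c * t))) (Set.Ioi 0) := by
  have := integrableOn_rpow_mul_exp_neg_mul_rpow (p := 1) (s := p - 1) (b := c) (by linarith)
    one_pos hc
  simpa using this

/-- Half of the rate `c` pays for the growth of (a+t)^γ. The majorant is uniform in the shift and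
the rate, so it serves both the continuity and the differentiation arguments below. -/
lemma exists_shiftedGamma_bound {p γ c δ R : ℝ} (hc : 0 < c)
    (h : 0 < δ ∨ (0 ≤ γ ∧ 0 ≤ δ)) :
    ∃ C, 0 ≤ C ∧ ∀ a, δ ≤ a → a ≤ R → ∀ t, 0 < t → ∀ c', c ≤ c' →
      ‖t ^ (p - 1) * (a + t) ^ γ * Real.exp (-(c' * t))‖ ≤
        C * (t ^ (p - 1) * Real.exp (-(c / 2 * t))) := by
  obtain ⟨C, hC, hb⟩ := exists_rpow_le_mul_exp (γ := γ) (half_pos hc) h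
  have hδ : 0 ≤ δ := h.elim le_of_lt And.right
  refine ⟨C * Real.exp (c / 2 * R), by positivity, fun a ha haR t ht c' hc' => ?_⟩
  have h0 : 0 ≤ a + t := by linarith
  rw [Real.norm_of_nonneg (by positivity)]
  have h1 := hb (a + t) (by linarith)
  have h2 : Real.exp (-(c' * t)) ≤ Real.exp (-(c * t)) := by
    apply Real.exp_le_exp.2; nlinarith
  have h3 : Real.exp (c / 2 * (a + t)) ≤ Real.exp (c / 2 * R) * Real.exp (c / 2 * t) := by
    rw [← Real.exp_add]; apply Real.exp_le_exp.2; nlinarith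
  have h4 : Real.exp (c / 2 * t) * Real.exp (-(c * t)) = Real.exp (-(c / 2 * t)) := by
    rw [← Real.exp_add]; congr 1; ring
  calc t ^ (p - 1) * (a + t) ^ γ * Real.exp (-(c' * t))
      ≤ t ^ (p - 1) * (C * (Real.exp (c / 2 * R) * Real.exp (c / 2 * t))) *
          Real.exp (-(c * t)) := by gcongr; exact h1.trans (by gcongr)
    _ = C * Real.exp (c / 2 * R) * (t ^ (p - 1) *
          (Real.exp (c / 2 * t) * Real.exp (-(c * t)))) := by ring
    _ = _ := by rw [h4]

lemma measurable_shiftedGamma_integrand (p γ c a : ℝ) :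
    Measurable fun t : ℝ => t ^ (p - 1) * (a + t) ^ γ * Real.exp (-(c * t)) := by
  fun_prop

lemma integrableOn_shiftedGamma {p γ c a : ℝ} (hp : 0 < p) (hc : 0 < c)
    (h : 0 < a ∨ (0 ≤ γ ∧ 0 ≤ a)) :
    IntegrableOn (fun t : ℝ => t ^ (p - 1) * (a + t) ^ γ * Real.exp (-(c * t))) (Set.Ioi 0) := by
  obtain ⟨C, -, hb⟩ := exists_shiftedGamma_bound (p := p) (R := a) hc h
  refine ((integrableOn_rpow_mul_exp_neg hp (half_pos hc)).const_mul C).mono'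
    (measurable_shiftedGamma_integrand p γ c a).aestronglyMeasurable ?_
  filter_upwards [self_mem_ae_restrict measurableSet_Ioi] with t ht
  exact hb a le_rfl le_rfl t ht c le_rfl

lemma continuousOn_shiftedGamma_Ici {p γ c δ : ℝ} (hp : 0 < p) (hc : 0 < c)
    (h : 0 < δ ∨ (0 ≤ γ ∧ 0 ≤ δ)) : ContinuousOn (shiftedGamma p γ c) (Set.Ici δ) := by
  intro a₀ ha₀
  obtain ⟨C, -, hb⟩ := exists_shiftedGamma_bound (p := p) (R := a₀ + 1) hc h
  refine continuousWithinAt_of_dominated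
    (bound := fun t => C * (t ^ (p - 1) * Real.exp (-(c / 2 * t)))) ?_ ?_
    ((integrableOn_rpow_mul_exp_neg hp (half_pos hc)).const_mul C) ?_
  · exact Eventually.of_forall fun a =>
      (measurable_shiftedGamma_integrand p γ c a).aestronglyMeasurable
  · filter_upwards [self_mem_nhdsWithin,
      mem_nhdsWithin_of_mem_nhds (Iic_mem_nhds (lt_add_one a₀))] with a ha ha'
    filter_upwards [self_mem_ae_restrict measurableSet_Ioi] with t ht
    exact hb a ha ha' t ht c le_rfl
  · filter_upwards [self_mem_ae_restrict measurableSet_Ioi] with t ht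
    have hδ : 0 ≤ δ := h.elim le_of_lt And.right
    have ha₀' : δ ≤ a₀ := ha₀
    have ht' : 0 < t := ht
    have : a₀ + t ≠ 0 := by linarith
    have h1 : ContinuousAt (fun a : ℝ => (a + t) ^ γ) a₀ :=
      ContinuousAt.rpow_const (by fun_prop) (Or.inl this)
    exact ((continuousAt_const.mul h1).mul continuousAt_const).continuousWithinAt

lemma continuousOn_shiftedGamma_Ioi {p γ c : ℝ} (hp : 0 < p) (hc : 0 < c) :
    ContinuousOn (shiftedGamma p γ c) (Set.Ioi 0) := by
  intro a ha
  have ha' : 0 < a := ha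
  exact ((continuousOn_shiftedGamma_Ici hp hc (Or.inl (half_pos ha'))).continuousAt
    (Ici_mem_nhds (half_lt_self ha'))).continuousWithinAt

lemma hasDerivAt_shiftedGamma {p γ c a : ℝ} (hp : 0 < p) (hc : 0 < c) (ha : 0 < a) :
    HasDerivAt (fun c => shiftedGamma p γ c a) (-shiftedGamma (p + 1) γ c a) c := by
  obtain ⟨C, -, hb⟩ := exists_shiftedGamma_bound (p := p + 1) (R := a) (half_pos hc)
    (γ := γ) (Or.inl ha)
  have key := hasDerivAt_integral_of_dominated_loc_of_deriv_le
    (F := fun c t : ℝ => t ^ (p - 1) * (a + t) ^ γ * Real.exp (-(c * t)))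
    (F' := fun c t : ℝ => -(t ^ (p + 1 - 1) * (a + t) ^ γ * Real.exp (-(c * t))))
    (μ := volume.restrict (Set.Ioi 0)) (x₀ := c) (s := Set.Ioi (c / 2))
    -- One halving of `c` gives room for the rate to vary, the other is spent in
    -- `exists_shiftedGamma_bound`.
    (bound := fun t => C * (t ^ (p + 1 - 1) * Real.exp (-(c / 2 / 2 * t))))
    (Ioi_mem_nhds (half_lt_self hc))
    (Eventually.of_forall fun c => (measurable_shiftedGamma_integrand p γ c a).aestronglyMeasurable)
    (integrableOn_shiftedGamma hp hc (Or.inl ha))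
    (measurable_shiftedGamma_integrand (p + 1) γ c a).neg.aestronglyMeasurable ?_
    ((integrableOn_rpow_mul_exp_neg (by linarith) (half_pos (half_pos hc))).const_mul C) ?_
  · have := key.2
    rwa [integral_neg] at this
  · filter_upwards [self_mem_ae_restrict measurableSet_Ioi] with t ht c' hc'
    rw [norm_neg]
    exact hb a le_rfl le_rfl t ht c' (le_of_lt hc')
  · filter_upwards [self_mem_ae_restrict measurableSet_Ioi] with t ht c' _
    have ht' : (0 : ℝ) < t := ht
    have h1 : HasDerivAt (fun c : ℝ => Real.exp (-(c * t))) (Real.exp (-(c' * t)) * -(1 * t)) c' :=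
      ((hasDerivAt_id c').mul_const t).neg.exp
    convert! h1.const_mul (t ^ (p - 1) * (a + t) ^ γ) using 1
    have : t ^ (p + 1 - 1) = t ^ (p - 1) * t := by
      rw [← Real.rpow_add_one ht'.ne']; congr 1; ring
    rw [this]; ring

/-- For exponents p' in (p/2, 2p), the power t^(p'-1) is dominated by t^(p/2-1) when t ≤ 1 and by
t^(2p-1) when t ≥ 1. This continuity is what allows the limit to an integer second parameter of
Tricomi's function. -/
lemma continuousAt_shiftedGamma_left {p γ c a : ℝ} (hp : 0 < p) (hc : 0 < c) (ha : 0 < a) :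
    ContinuousAt (fun p => shiftedGamma p γ c a) p := by
  refine continuousAt_of_dominated
    (bound := fun t => t ^ (p / 2 - 1) * (a + t) ^ γ * Real.exp (-(c * t)) +
      t ^ (2 * p - 1) * (a + t) ^ γ * Real.exp (-(c * t))) ?_ ?_
    ((integrableOn_shiftedGamma (half_pos hp) hc (Or.inl ha)).add
      (integrableOn_shiftedGamma (by linarith) hc (Or.inl ha))) ?_
  · exact Eventually.of_forall fun p =>
      (measurable_shiftedGamma_integrand p γ c a).aestronglyMeasurable
  · filter_upwards [Ioo_mem_nhds (half_lt_self hp) (by linarith : p < 2 * p)] with p' hp'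
    filter_upwards [self_mem_ae_restrict measurableSet_Ioi] with t ht
    have ht' : (0 : ℝ) < t := ht
    have : 0 < a + t := by linarith
    rw [Real.norm_of_nonneg (by positivity), ← add_mul, ← add_mul]
    gcongr
    rcases le_total t 1 with h | h
    · exact (Real.rpow_le_rpow_of_exponent_ge ht' h (by linarith [hp'.1])).trans
        (le_add_of_nonneg_right (by positivity))
    · exact (Real.rpow_le_rpow_of_exponent_le h (by linarith [hp'.2])).trans
        (le_add_of_nonneg_left (by positivity))
  · filter_upwards [self_mem_ae_restrict measurableSet_Ioi] with t ht
    have ht' : t ≠ 0 := ne_of_gt ht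
    have : ContinuousAt (fun p : ℝ => t ^ (p - 1)) p :=
      ContinuousAt.rpow continuousAt_const (by fun_prop) (Or.inl ht')
    exact (this.mul continuousAt_const).mul continuousAt_const

/-- Rescaling the variable of integration. -/
lemma shiftedGamma_eq_rpow_mul {p γ c a : ℝ} (hc : 0 < c) (ha : 0 ≤ a) :
    shiftedGamma p γ c a = c ^ (-(p + γ)) * shiftedGamma p γ 1 (c * a) := by
  have h := integral_comp_mul_left_Ioi
    (fun y : ℝ => y ^ (p - 1) * (c * a + y) ^ γ * Real.exp (-(1 * y))) 0 hc
  rw [mul_zero] at h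
  have h' : shiftedGamma p γ 1 (c * a) = c * ∫ t in Set.Ioi (0 : ℝ),
      (c * t) ^ (p - 1) * (c * a + c * t) ^ γ * Real.exp (-(1 * (c * t))) := by
    rw [h, smul_eq_mul, ← mul_assoc, mul_inv_cancel₀ hc.ne', one_mul, shiftedGamma]
  rw [h', ← integral_const_mul, ← integral_const_mul, shiftedGamma]
  refine setIntegral_congr_fun measurableSet_Ioi fun t ht => ?_
  have ht' : (0 : ℝ) < t := ht
  have h1 : (c * t) ^ (p - 1) = c ^ (p - 1) * t ^ (p - 1) := Real.mul_rpow hc.le ht'.le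
  have h2 : (c * a + c * t) ^ γ = c ^ γ * (a + t) ^ γ := by
    rw [← mul_add, Real.mul_rpow hc.le (by linarith)]
  have h3 : c ^ (-(p + γ)) * c * c ^ (p - 1) * c ^ γ = 1 := by
    rw [← Real.rpow_add_one hc.ne', ← Real.rpow_add hc, ← Real.rpow_add hc,
      ← Real.rpow_zero c]
    congr 1; ring
  simp only [h1, h2, one_mul]
  linear_combination (-(t ^ (p - 1) * (a + t) ^ γ * Real.exp (-(c * t)))) * h3

lemma shiftedGamma_nonneg {p γ c a : ℝ} (ha : 0 ≤ a) : 0 ≤ shiftedGamma p γ c a := by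
  refine setIntegral_nonneg measurableSet_Ioi fun t ht => ?_
  have : (0 : ℝ) < t := ht
  positivity

/-- The contiguous relation that expresses Kummer's equation. -/
lemma shiftedGamma_kummer {p q z : ℝ} (hp : 0 < p) (hz : 0 < z) :
    p * shiftedGamma p (q - p - 1) z 1 + (q - z) * shiftedGamma (p + 1) (q - p - 1) z 1
      - z * shiftedGamma (p + 2) (q - p - 1) z 1 = 0 := by
  have i0 := integrableOn_shiftedGamma (γ := q - p - 1) (a := 1) hp hz (Or.inl one_pos)
  have i1 := integrableOn_shiftedGamma (p := p + 1) (γ := q - p - 1) (a := 1) (by linarith) hz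
    (Or.inl one_pos)
  have i2 := integrableOn_shiftedGamma (p := p + 2) (γ := q - p - 1) (a := 1) (by linarith) hz
    (Or.inl one_pos)
  have j := ((i0.const_mul p).add (i1.const_mul (q - z))).sub (i2.const_mul z)
  -- The combined integrand is the derivative of t^p (1+t)^(q-p) e^(-zt), which vanishes at both
  -- ends of the half line.
  have hcont : ContinuousAt (fun t : ℝ => t ^ p * (1 + t) ^ (q - p) * Real.exp (-(z * t))) 0 :=
    ((ContinuousAt.rpow_const continuousAt_id (Or.inr hp.le)).mul
      (ContinuousAt.rpow_const (by fun_prop) (Or.inl (by norm_num)))).mul (by fun_prop)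
  have hlim1 : Tendsto (fun t : ℝ => t ^ p * (1 + t) ^ (q - p) * Real.exp (-(z * t)))
      atTop (𝓝 0) := by
    obtain ⟨C, hC, hb⟩ := exists_rpow_le_mul_exp (γ := q - p) (δ := 1) (half_pos hz)
      (Or.inl one_pos)
    have h1 : Tendsto (fun t : ℝ => C * Real.exp (z / 2) * (t ^ p * Real.exp (-(z / 2) * t)))
        atTop (𝓝 0) := by
      simpa using (tendsto_rpow_mul_exp_neg_mul_atTop_nhds_zero p (z / 2) (half_pos hz)).const_mul
        (C * Real.exp (z / 2))
    refine squeeze_zero' ?_ ?_ h1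
    · filter_upwards [eventually_gt_atTop 0] with t ht
      positivity
    · filter_upwards [eventually_gt_atTop 0] with t ht
      have h2 := hb (1 + t) (by linarith)
      have h3 : Real.exp (z / 2 * (1 + t)) * Real.exp (-(z * t)) =
          Real.exp (z / 2) * Real.exp (-(z / 2) * t) := by
        rw [← Real.exp_add, ← Real.exp_add]; congr 1; ring
      calc t ^ p * (1 + t) ^ (q - p) * Real.exp (-(z * t))
          ≤ t ^ p * (C * Real.exp (z / 2 * (1 + t))) * Real.exp (-(z * t)) := by gcongr
        _ = t ^ p * C * (Real.exp (z / 2 * (1 + t)) * Real.exp (-(z * t))) := by ring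
        _ = _ := by rw [h3]; ring
  have hcalc : ∀ t ∈ Set.Ioi (0 : ℝ),
      HasDerivAt (fun t : ℝ => t ^ p * (1 + t) ^ (q - p) * Real.exp (-(z * t)))
        (p * (t ^ (p - 1) * (1 + t) ^ (q - p - 1) * Real.exp (-(z * t)))
          + (q - z) * (t ^ (p + 1 - 1) * (1 + t) ^ (q - p - 1) * Real.exp (-(z * t)))
          - z * (t ^ (p + 2 - 1) * (1 + t) ^ (q - p - 1) * Real.exp (-(z * t)))) t := by
    intro t ht
    have ht' : (0 : ℝ) < t := ht
    have d1 := Real.hasDerivAt_rpow_const (x := t) (p := p) (Or.inl ht'.ne')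
    have d2 : HasDerivAt (fun t : ℝ => (1 + t) ^ (q - p)) (1 * (q - p) * (1 + t) ^ (q - p - 1)) t :=
      ((hasDerivAt_id t).const_add 1).rpow_const (Or.inl (by simp; linarith))
    have d3 : HasDerivAt (fun t : ℝ => Real.exp (-(z * t))) (Real.exp (-(z * t)) * -(z * 1)) t :=
      ((hasDerivAt_id t).const_mul z).neg.exp
    convert! (d1.mul d2).mul d3 using 1
    have e0 : t ^ p = t ^ (p - 1) * t := by rw [← Real.rpow_add_one ht'.ne']; congr 1; ring
    have e1 : t ^ (p + 1 - 1) = t ^ (p - 1) * t := by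
      rw [← Real.rpow_add_one ht'.ne']; congr 1; ring
    have e2 : t ^ (p + 2 - 1) = t ^ (p - 1) * t * t := by
      rw [← Real.rpow_add_one ht'.ne', ← Real.rpow_add_one ht'.ne']; congr 1; ring
    have e3 : (1 + t) ^ (q - p) = (1 + t) ^ (q - p - 1) * (1 + t) := by
      rw [← Real.rpow_add_one (by linarith)]; congr 1; ring
    simp only [Pi.mul_apply, e0, e1, e2, e3]
    ring
  have h := integral_Ioi_of_hasDerivAt_of_tendsto hcont.continuousWithinAt hcalc j hlim1
  have e1 := integral_sub ((i0.const_mul p).add (i1.const_mul (q - z))) (i2.const_mul z)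
  have e2 := integral_add (i0.const_mul p) (i1.const_mul (q - z))
  simp only [Pi.add_apply] at e1 e2
  rw [e1, e2, integral_const_mul, integral_const_mul, integral_const_mul] at h
  simpa [Real.zero_rpow hp.ne', shiftedGamma] using h

/-! ### Limits of the integral as its rate or its shift tends to 0. -/

/-- The beta integral over the half line. -/
lemma lintegral_rpow_mul_one_add_rpow {p r : ℝ} (hp : 0 < p) (hpr : p < r) :
    ∫⁻ t in Set.Ioi (0 : ℝ), ENNReal.ofReal (t ^ (p - 1) * (1 + t) ^ (-r)) =
      ENNReal.ofReal (Real.Gamma p * Real.Gamma (r - p) / Real.Gamma r) := by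
  have hr : 0 < r := hp.trans hpr
  have hΓ := Real.Gamma_pos_of_pos hr
  have gam : ∀ {a c : ℝ}, 0 < a → 0 < c →
      ∫⁻ s in Set.Ioi (0 : ℝ), ENNReal.ofReal (s ^ (a - 1) * Real.exp (-(c * s))) =
        ENNReal.ofReal (c ^ (-a) * Real.Gamma a) := by
    intro a c ha hc
    rw [← ofReal_integral_eq_lintegral_ofReal (integrableOn_rpow_mul_exp_neg ha hc),
      Real.integral_rpow_mul_exp_neg_mul_Ioi ha hc, one_div, Real.inv_rpow hc.le,
      Real.rpow_neg hc.le]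
    filter_upwards [self_mem_ae_restrict measurableSet_Ioi] with s hs
    have : (0 : ℝ) < s := hs
    simp only [Pi.zero_apply]
    positivity
  -- Write (1+t)^(-r) as a gamma integral in s and exchange the integrals by Tonelli.
  have h1 : ∀ t ∈ Set.Ioi (0 : ℝ), ENNReal.ofReal (t ^ (p - 1) * (1 + t) ^ (-r)) =
      ENNReal.ofReal (Real.Gamma r)⁻¹ * ∫⁻ s in Set.Ioi (0 : ℝ),
        ENNReal.ofReal (t ^ (p - 1) * (s ^ (r - 1) * Real.exp (-((1 + t) * s)))) := by
    intro t ht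
    have ht' : (0 : ℝ) < t := ht
    have hc : 0 < 1 + t := by linarith
    have h0 : 0 ≤ t ^ (p - 1) := by positivity
    simp_rw [ENNReal.ofReal_mul h0]
    rw [lintegral_const_mul _ (by fun_prop), gam hr hc, mul_left_comm,
      ← ENNReal.ofReal_mul (p := (Real.Gamma r)⁻¹) (by positivity), mul_comm (Real.Gamma r)⁻¹,
      mul_assoc, mul_inv_cancel₀ hΓ.ne', mul_one]
  have h2 : ∀ s ∈ Set.Ioi (0 : ℝ), ∫⁻ t in Set.Ioi (0 : ℝ),
      ENNReal.ofReal (t ^ (p - 1) * (s ^ (r - 1) * Real.exp (-((1 + t) * s)))) =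
        ENNReal.ofReal (Real.Gamma p) *
          ENNReal.ofReal (s ^ (r - p - 1) * Real.exp (-(1 * s))) := by
    intro s hs
    have hs' : (0 : ℝ) < s := hs
    have : ∀ t : ℝ, ENNReal.ofReal (t ^ (p - 1) * (s ^ (r - 1) * Real.exp (-((1 + t) * s)))) =
        ENNReal.ofReal (s ^ (r - 1) * Real.exp (-s)) *
          ENNReal.ofReal (t ^ (p - 1) * Real.exp (-(s * t))) := by
      intro t
      rw [← ENNReal.ofReal_mul (by positivity)]
      congr 1
      have : Real.exp (-((1 + t) * s)) = Real.exp (-s) * Real.exp (-(s * t)) := by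
        rw [← Real.exp_add]; congr 1; ring
      rw [this]; ring
    simp_rw [this]
    rw [lintegral_const_mul _ (by fun_prop), gam hp hs',
      ← ENNReal.ofReal_mul (by positivity), ← ENNReal.ofReal_mul (by positivity)]
    congr 1
    have : s ^ (r - p - 1) = s ^ (r - 1) * s ^ (-p) := by
      rw [← Real.rpow_add hs']; congr 1; ring
    rw [this, one_mul]; ring
  rw [setLIntegral_congr_fun measurableSet_Ioi h1, lintegral_const_mul' _ _ ENNReal.ofReal_ne_top,
    lintegral_lintegral_swap (by fun_prop), setLIntegral_congr_fun measurableSet_Ioi h2,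
    lintegral_const_mul _ (by fun_prop), gam (by linarith) one_pos,
    ← ENNReal.ofReal_mul (by positivity), ← ENNReal.ofReal_mul (by positivity)]
  congr 1
  rw [Real.one_rpow]; field_simp

lemma integrableOn_rpow_mul_one_add_rpow {p r : ℝ} (hp : 0 < p) (hpr : p < r) :
    IntegrableOn (fun t : ℝ => t ^ (p - 1) * (1 + t) ^ (-r)) (Set.Ioi 0) := by
  refine ⟨by fun_prop, ?_⟩
  rw [hasFiniteIntegral_iff_ofReal, lintegral_rpow_mul_one_add_rpow hp hpr]
  · exact ENNReal.ofReal_lt_top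
  · filter_upwards [self_mem_ae_restrict measurableSet_Ioi] with s hs
    have : (0 : ℝ) < s := hs
    simp only [Pi.zero_apply]
    positivity

lemma integral_rpow_mul_one_add_rpow {p r : ℝ} (hp : 0 < p) (hpr : p < r) :
    ∫ t in Set.Ioi (0 : ℝ), t ^ (p - 1) * (1 + t) ^ (-r) =
      Real.Gamma p * Real.Gamma (r - p) / Real.Gamma r := by
  have h := lintegral_rpow_mul_one_add_rpow hp hpr
  have h1 := Real.Gamma_pos_of_pos hp
  have h2 := Real.Gamma_pos_of_pos (sub_pos.2 hpr)
  have h3 := Real.Gamma_pos_of_pos (hp.trans hpr)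
  rw [← ofReal_integral_eq_lintegral_ofReal (integrableOn_rpow_mul_one_add_rpow hp hpr),
    ENNReal.ofReal_eq_ofReal_iff _ (by positivity)] at h
  · exact h
  · refine setIntegral_nonneg measurableSet_Ioi fun t ht => ?_
    have : (0 : ℝ) < t := ht
    positivity
  · filter_upwards [self_mem_ae_restrict measurableSet_Ioi] with s hs
    have : (0 : ℝ) < s := hs
    simp only [Pi.zero_apply]
    positivity

lemma tendsto_shiftedGamma_rate_zero {p r : ℝ} (hp : 0 < p) (hpr : p < r) :
    Tendsto (fun c => shiftedGamma p (-r) c 1) (𝓝[>] 0)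
      (𝓝 (Real.Gamma p * Real.Gamma (r - p) / Real.Gamma r)) := by
  rw [← integral_rpow_mul_one_add_rpow hp hpr]
  refine tendsto_integral_filter_of_dominated_convergence _ ?_ ?_
    (integrableOn_rpow_mul_one_add_rpow hp hpr) ?_
  · exact Eventually.of_forall fun c =>
      (measurable_shiftedGamma_integrand p _ c 1).aestronglyMeasurable
  · filter_upwards [self_mem_nhdsWithin] with c hc
    filter_upwards [self_mem_ae_restrict measurableSet_Ioi] with t ht
    have ht' : (0 : ℝ) < t := ht
    have hc' : (0 : ℝ) < c := hc
    rw [Real.norm_of_nonneg (by positivity)]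
    refine mul_le_of_le_one_right (by positivity) (Real.exp_le_one_iff.2 ?_)
    have := mul_pos hc' ht'
    linarith
  · refine Eventually.of_forall fun t => ?_
    have : ContinuousAt (fun c : ℝ => t ^ (p - 1) * (1 + t) ^ (-r) * Real.exp (-(c * t))) 0 := by
      fun_prop
    have h := this.tendsto
    simp only [zero_mul, neg_zero, Real.exp_zero, mul_one] at h
    exact h.mono_left nhdsWithin_le_nhds

/-- Since γ ≤ 0, the integrand at shift 0 dominates. After rescaling, this limit gives the singular
behaviour at 0 of the derivative of the integral solution of Kummer's equation. -/
lemma tendsto_shiftedGamma_shift_zero {p γ : ℝ} (hγ : γ ≤ 0) (hpγ : 0 < p + γ) :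
    Tendsto (fun a => shiftedGamma p γ 1 a) (𝓝[>] 0) (𝓝 (Real.Gamma (p + γ))) := by
  have hlim : Real.Gamma (p + γ) =
      ∫ t in Set.Ioi (0 : ℝ), t ^ (p + γ - 1) * Real.exp (-(1 * t)) := by
    rw [Real.integral_rpow_mul_exp_neg_mul_Ioi hpγ one_pos]; simp
  rw [hlim]
  have hsplit : ∀ t : ℝ, 0 < t → t ^ (p + γ - 1) = t ^ (p - 1) * t ^ γ := fun t ht => by
    rw [← Real.rpow_add ht]; congr 1; ring
  refine tendsto_integral_filter_of_dominated_convergence _ ?_ ?_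
    (integrableOn_rpow_mul_exp_neg hpγ one_pos) ?_
  · exact Eventually.of_forall fun a =>
      (measurable_shiftedGamma_integrand p _ 1 a).aestronglyMeasurable
  · filter_upwards [self_mem_nhdsWithin] with a ha
    filter_upwards [self_mem_ae_restrict measurableSet_Ioi] with t ht
    have ht' : (0 : ℝ) < t := ht
    have ha' : (0 : ℝ) < a := ha
    rw [Real.norm_of_nonneg (by positivity), hsplit t ht']
    have := Real.rpow_le_rpow_of_nonpos ht' (by linarith : t ≤ a + t) hγ
    gcongr
  · filter_upwards [self_mem_ae_restrict measurableSet_Ioi] with t ht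
    have ht' : (0 : ℝ) < t := ht
    have : ContinuousAt (fun a : ℝ => t ^ (p - 1) * (a + t) ^ γ * Real.exp (-(1 * t))) 0 :=
      (continuousAt_const.mul (ContinuousAt.rpow_const (by fun_prop)
        (Or.inl (by simpa using ht'.ne')))).mul continuousAt_const
    have h := this.tendsto
    simp only [zero_add] at h
    rw [hsplit t ht']
    exact h.mono_left nhdsWithin_le_nhds

/-! ### Kummer's series -/

lemma summable_nat_mul_pow {c : ℕ → ℝ} (hc : ∀ R : ℝ, Summable fun j => c j * R ^ j) (R : ℝ) :
    Summable fun j : ℕ => |c j| * (j * |R| ^ (j - 1)) := by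
  refine Summable.of_nonneg_of_le (fun j => by positivity) (fun j => ?_)
    (hc (2 * (|R| + 1))).abs
  rw [abs_mul, abs_pow, abs_of_nonneg (by positivity : (0 : ℝ) ≤ 2 * (|R| + 1)), mul_pow]
  -- The factor j is absorbed by doubling the radius; convergence is assumed at every radius.
  have h1 : (j : ℝ) ≤ 2 ^ j := by exact_mod_cast j.lt_two_pow_self.le
  have h2 : |R| ^ (j - 1) ≤ (|R| + 1) ^ j :=
    (pow_le_pow_left₀ (abs_nonneg R) (by linarith) _).trans
      (pow_le_pow_right₀ (by linarith [abs_nonneg R]) (Nat.sub_le _ _))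
  gcongr

lemma summable_deriv_coeff {c : ℕ → ℝ} (hc : ∀ R : ℝ, Summable fun j => c j * R ^ j) (R : ℝ) :
    Summable fun j : ℕ => (j + 1) * c (j + 1) * R ^ j := by
  have := (summable_nat_add_iff 1).2 (summable_nat_mul_pow hc R)
  refine this.of_norm_bounded fun j => le_of_eq ?_
  rw [Real.norm_eq_abs, abs_mul, abs_mul, abs_pow, abs_of_nonneg (by positivity : (0 : ℝ) ≤ j + 1)]
  push_cast
  ring

lemma hasDerivAt_tsum_coeff_mul_pow {c : ℕ → ℝ} (hc : ∀ R : ℝ, Summable fun j => c j * R ^ j)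
    (z : ℝ) : HasDerivAt (fun z => ∑' j, c j * z ^ j) (∑' j : ℕ, (j + 1) * c (j + 1) * z ^ j) z := by
  have hz : z ∈ Metric.ball (0 : ℝ) (|z| + 1) := by simp
  have h := hasDerivAt_tsum_of_isPreconnected (𝕜 := ℝ) (t := Metric.ball (0 : ℝ) (|z| + 1))
    (g := fun j z => c j * z ^ j) (g' := fun j z => c j * (j * z ^ (j - 1)))
    (summable_nat_mul_pow hc (|z| + 1)) Metric.isOpen_ball
    (convex_ball _ _).isPreconnected (fun j y _ => (hasDerivAt_pow j y).const_mul (c j)) ?_ hz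
    (hc z) hz
  · convert! h using 1
    have hs : Summable fun j : ℕ => c j * (j * z ^ (j - 1)) := by
      refine (summable_nat_mul_pow hc z).of_norm_bounded fun j => le_of_eq ?_
      rw [Real.norm_eq_abs, abs_mul, abs_mul, abs_pow, Nat.abs_cast]
    rw [hs.tsum_eq_zero_add]
    simp only [Nat.cast_zero, zero_mul, mul_zero, zero_add]
    refine tsum_congr fun j => ?_
    push_cast
    ring
  · intro j y hy
    have hy' : |y| ≤ |(|z| + 1)| := by
      rw [abs_of_nonneg (by positivity : 0 ≤ |z| + 1)]
      simpa using (mem_ball_zero_iff.1 hy).le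
    rw [Real.norm_eq_abs, abs_mul, abs_mul, abs_pow, Nat.abs_cast]
    gcongr

lemma hasSum_mul_self {c c' : ℕ → ℝ} {z A : ℝ} (h : HasSum (fun j => c j * z ^ j) A)
    (h0 : c' 0 = 0) (hs : ∀ j, c' (j + 1) = c j) : HasSum (fun j => c' j * z ^ j) (z * A) := by
  rw [← hasSum_nat_add_iff' 1]
  simp only [Finset.range_one, Finset.sum_singleton, h0, zero_mul, sub_zero, hs]
  convert! h.mul_left z using 2
  ring

/-- The coefficients of `hyp1F1 a b`. -/
noncomputable def kummerCoeff (a b : ℝ) (j : ℕ) : ℝ :=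
  (ascPochhammer ℝ j).eval a / (ascPochhammer ℝ j).eval b / (j.factorial : ℝ)

lemma hyp1F1_eq_tsum (a b x : ℝ) : hyp1F1 a b x = ∑' j, kummerCoeff a b j * x ^ j := by
  unfold hyp1F1 kummerCoeff
  exact tsum_congr fun j => by ring

@[simp] lemma kummerCoeff_zero (a b : ℝ) : kummerCoeff a b 0 = 1 := by simp [kummerCoeff]

lemma kummerCoeff_succ {a b : ℝ} (hb : ∀ j : ℕ, b + j ≠ 0) (j : ℕ) :
    (j + 1) * kummerCoeff a b (j + 1) = kummerCoeff a b j * (a + j) / (b + j) := by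
  have := hb j
  simp only [kummerCoeff, ascPochhammer_succ_eval, Nat.factorial_succ]
  push_cast
  have : (j : ℝ) + 1 ≠ 0 := by positivity
  field_simp

lemma ascPochhammer_eval_ne_zero {b : ℝ} (hb : ∀ j : ℕ, b + j ≠ 0) (j : ℕ) :
    (ascPochhammer ℝ j).eval b ≠ 0 := by
  induction j with
  | zero => simp
  | succ j ih => rw [ascPochhammer_succ_eval]; exact mul_ne_zero ih (hb j)

lemma mul_ascPochhammer_eval_add_one (b : ℝ) (j : ℕ) :
    b * (ascPochhammer ℝ j).eval (b + 1) = (ascPochhammer ℝ j).eval b * (b + j) := by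
  rw [← ascPochhammer_succ_eval, ascPochhammer_succ_left]
  simp

lemma summable_kummerCoeff {a b : ℝ} (hb : ∀ j : ℕ, b + j ≠ 0) (R : ℝ) :
    Summable fun j => kummerCoeff a b j * R ^ j := by
  have hlim : Tendsto (fun j : ℕ => ‖(a + j) / (b + j) * (R * (1 / ((j : ℝ) + 1)))‖) atTop (𝓝 0) := by
    have h1 : Tendsto (fun j : ℕ => (a + j) / (b + j)) atTop (𝓝 1) := by
      have := tendsto_add_mul_div_add_mul_atTop_nhds a b 1 (one_ne_zero (α := ℝ))
      simpa using this
    have h2 : Tendsto (fun j : ℕ => R * (1 / ((j : ℝ) + 1))) atTop (𝓝 0) := by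
      simpa using tendsto_one_div_add_atTop_nhds_zero_nat.const_mul R
    simpa using (h1.mul h2).norm
  refine summable_of_ratio_norm_eventually_le (r := 1 / 2) (by norm_num) ?_
  filter_upwards [hlim.eventually_le_const (by norm_num : (0 : ℝ) < 1 / 2)] with j hj
  have h1 : kummerCoeff a b (j + 1) * R ^ (j + 1) =
      ((a + j) / (b + j) * (R * (1 / ((j : ℝ) + 1)))) * (kummerCoeff a b j * R ^ j) := by
    have h2 := kummerCoeff_succ (a := a) hb j
    have h3 : (j : ℝ) + 1 ≠ 0 := by positivity
    have h4 : kummerCoeff a b (j + 1) = kummerCoeff a b j * (a + j) / (b + j) / (j + 1) := by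
      rw [← h2]; field_simp
    rw [h4, pow_succ]; ring
  rw [h1, norm_mul]
  gcongr

/-- The derivative of `hyp1F1 a b`. -/
noncomputable def hyp1F1Deriv (a b z : ℝ) : ℝ :=
  ∑' j : ℕ, (j + 1) * kummerCoeff a b (j + 1) * z ^ j

/-- The second derivative of `hyp1F1 a b`. -/
noncomputable def hyp1F1Deriv2 (a b z : ℝ) : ℝ :=
  ∑' j : ℕ, ((j : ℝ) + 1) * (((j + 1 : ℕ) + 1) * kummerCoeff a b (j + 1 + 1)) * z ^ j

lemma hasSum_hyp1F1 {a b : ℝ} (hb : ∀ j : ℕ, b + j ≠ 0) (z : ℝ) :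
    HasSum (fun j => kummerCoeff a b j * z ^ j) (hyp1F1 a b z) := by
  rw [hyp1F1_eq_tsum]
  exact (summable_kummerCoeff hb z).hasSum

lemma hasSum_hyp1F1Deriv {a b : ℝ} (hb : ∀ j : ℕ, b + j ≠ 0) (z : ℝ) :
    HasSum (fun j : ℕ => (j + 1) * kummerCoeff a b (j + 1) * z ^ j) (hyp1F1Deriv a b z) :=
  (summable_deriv_coeff (summable_kummerCoeff hb) z).hasSum

lemma hasDerivAt_hyp1F1 {a b : ℝ} (hb : ∀ j : ℕ, b + j ≠ 0) (z : ℝ) :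
    HasDerivAt (hyp1F1 a b) (hyp1F1Deriv a b z) z := by
  rw [show hyp1F1 a b = _ from funext (hyp1F1_eq_tsum a b)]
  exact hasDerivAt_tsum_coeff_mul_pow (summable_kummerCoeff hb) z

lemma hasDerivAt_hyp1F1Deriv {a b : ℝ} (hb : ∀ j : ℕ, b + j ≠ 0) (z : ℝ) :
    HasDerivAt (hyp1F1Deriv a b) (hyp1F1Deriv2 a b z) z :=
  hasDerivAt_tsum_coeff_mul_pow (summable_deriv_coeff (summable_kummerCoeff hb)) z

/-- Kummer's differential equation. -/
lemma hyp1F1_kummer {a b : ℝ} (hb : ∀ j : ℕ, b + j ≠ 0) (z : ℝ) :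
    z * hyp1F1Deriv2 a b z + (b - z) * hyp1F1Deriv a b z - a * hyp1F1 a b z = 0 := by
  have h0 := hasSum_hyp1F1 (a := a) hb z
  have h1 := hasSum_hyp1F1Deriv (a := a) hb z
  have h2 : HasSum (fun j : ℕ => ((j : ℝ) + 1) * (((j + 1 : ℕ) + 1) *
      kummerCoeff a b (j + 1 + 1)) * z ^ j) (hyp1F1Deriv2 a b z) :=
    (summable_deriv_coeff (summable_deriv_coeff (summable_kummerCoeff hb)) z).hasSum
  have h2' := hasSum_mul_self (c' := fun j => j * ((j + 1) * kummerCoeff a b (j + 1))) h2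
    (by simp) (fun j => by push_cast; ring)
  have h1' := hasSum_mul_self (c' := fun j => j * kummerCoeff a b j) h1
    (by simp) (fun j => by push_cast; ring)
  have h := ((h2'.add (h1.mul_left b)).sub h1').sub (h0.mul_left a)
  have hz : (fun j : ℕ => j * ((j + 1) * kummerCoeff a b (j + 1)) * z ^ j +
      b * ((j + 1) * kummerCoeff a b (j + 1) * z ^ j) - j * kummerCoeff a b j * z ^ j -
      a * (kummerCoeff a b j * z ^ j)) = fun _ => 0 := by
    funext j
    have hk := kummerCoeff_succ (a := a) hb j
    rw [eq_div_iff (hb j)] at hk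
    linear_combination z ^ j * hk
  rw [hz] at h
  linear_combination h.unique hasSum_zero

/-- Coefficientwise this is 1 - (a+j)/(b+j) = (b-a)/(b+j) with (b)_j (b+j) = b (b+1)_j. Subtracting
the derivative raises the second parameter, as it does for the integral; `hyp1F1_contiguous` plays
the same role for the second Kummer solution. -/
lemma hyp1F1_sub_deriv {a b : ℝ} (hb : ∀ j : ℕ, b + j ≠ 0) (z : ℝ) :
    hyp1F1 a b z - hyp1F1Deriv a b z = (b - a) / b * hyp1F1 a (b + 1) z := by
  have hb' : ∀ j : ℕ, b + 1 + j ≠ 0 := fun j => by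
    have := hb (j + 1); push_cast at this; rwa [add_assoc, add_comm (1 : ℝ)]
  refine ((hasSum_hyp1F1 (a := a) hb z).sub (hasSum_hyp1F1Deriv hb z)).unique ?_
  convert! (hasSum_hyp1F1 (a := a) hb' z).mul_left ((b - a) / b) using 2 with j
  rw [kummerCoeff_succ hb j]
  have h1 := mul_ascPochhammer_eval_add_one b j
  have h2 := ascPochhammer_eval_ne_zero hb j
  have h3 := ascPochhammer_eval_ne_zero hb' j
  have h4 := hb j
  have h5 : b ≠ 0 := by simpa using hb 0
  have h6 : (j.factorial : ℝ) ≠ 0 := by positivity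
  have h7 : (ascPochhammer ℝ j).eval (b + 1) = (ascPochhammer ℝ j).eval b * (b + j) / b := by
    rw [← h1]; field_simp
  simp only [kummerCoeff, h7]
  field_simp
  ring

lemma hyp1F1_contiguous {a s : ℝ} (hs : ∀ j : ℕ, s + j ≠ 0) (z : ℝ) :
    (s - z) * hyp1F1 a (s + 1) z + z * hyp1F1Deriv a (s + 1) z = s * hyp1F1 (a - 1) s z := by
  have hs' : ∀ j : ℕ, s + 1 + j ≠ 0 := fun j => by
    have := hs (j + 1); push_cast at this; rwa [add_assoc, add_comm (1 : ℝ)]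
  have h0 := hasSum_hyp1F1 (a := a) hs' z
  have h1 := hasSum_hyp1F1Deriv (a := a) hs' z
  have h1' := hasSum_mul_self (c' := fun j => j * kummerCoeff a (s + 1) j) h1
    (by simp) (fun j => by push_cast; ring)
  have h0' := hasSum_mul_self
    (c' := fun j => Nat.casesOn j 0 fun j => kummerCoeff a (s + 1) j) h0 rfl (fun j => rfl)
  rw [sub_mul]
  refine (((h0.mul_left s).sub h0').add h1').unique ?_
  convert! (hasSum_hyp1F1 (a := a - 1) hs z).mul_left s using 2 with j
  rcases j with _ | j
  · simp
  have e1 : (ascPochhammer ℝ (j + 1)).eval (a - 1) = (a - 1) * (ascPochhammer ℝ j).eval a := by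
    rw [ascPochhammer_succ_left]; simp
  have e2 : (ascPochhammer ℝ (j + 1)).eval s = s * (ascPochhammer ℝ j).eval (s + 1) := by
    rw [ascPochhammer_succ_left]; simp
  have h2 := ascPochhammer_eval_ne_zero hs' j
  have h3 := hs' j
  have h4 : s ≠ 0 := by simpa using hs 0
  have h5 : (j.factorial : ℝ) ≠ 0 := by positivity
  have h6 : (j : ℝ) + 1 ≠ 0 := by positivity
  simp only [kummerCoeff, e1, e2, ascPochhammer_succ_eval, Nat.factorial_succ]
  push_cast
  field_simp
  ring

lemma hyp1F1_zero_right (a b : ℝ) : hyp1F1 a b 0 = 1 := by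
  rw [hyp1F1_eq_tsum, tsum_eq_single 0 (fun j hj => by simp [hj])]
  simp

lemma one_le_hyp1F1 {a b z : ℝ} (ha : 0 < a) (hb : 0 < b) (hz : 0 < z) : 1 ≤ hyp1F1 a b z := by
  have hb' : ∀ j : ℕ, b + j ≠ 0 := fun j => by positivity
  have h := (summable_kummerCoeff (a := a) hb' z).le_tsum 0 (fun j _ => by
    have := ascPochhammer_pos j a ha
    have := ascPochhammer_pos j b hb
    unfold kummerCoeff
    positivity)
  rw [hyp1F1_eq_tsum]
  simpa using h

/-! ### Kummer's equation and the integral representation of Tricomi's function -/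

/-- `w` solves Kummer's equation `z w'' + (q - z) w' - p w = 0` on the positive half line and has
the derivative `w'` there. -/
def IsKummerSol (p q : ℝ) (w w' : ℝ → ℝ) : Prop :=
  ∀ z, 0 < z → HasDerivAt w (w' z) z ∧ HasDerivAt w' ((p * w z - (q - z) * w' z) / z) z

lemma IsKummerSol.const_mul {p q : ℝ} {w w' : ℝ → ℝ} (h : IsKummerSol p q w w') (c : ℝ) :
    IsKummerSol p q (fun z => c * w z) (fun z => c * w' z) := fun z hz => by
  refine ⟨(h z hz).1.const_mul c, ?_⟩
  convert! (h z hz).2.const_mul c using 1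
  ring

lemma IsKummerSol.sub {p q : ℝ} {w w' v v' : ℝ → ℝ} (h : IsKummerSol p q w w')
    (k : IsKummerSol p q v v') :
    IsKummerSol p q (fun z => w z - v z) (fun z => w' z - v' z) := fun z hz => by
  refine ⟨(h z hz).1.sub (k z hz).1, ?_⟩
  convert! (h z hz).2.sub (k z hz).2 using 1
  ring

lemma eq_of_hasDerivAt_zero_of_tendsto {f : ℝ → ℝ} {L : ℝ} (h : ∀ z, 0 < z → HasDerivAt f 0 z)
    (hf : Tendsto f (𝓝[>] 0) (𝓝 L)) {z : ℝ} (hz : 0 < z) : f z = L := by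
  obtain ⟨a, ha⟩ := isOpen_Ioi.exists_is_const_of_deriv_eq_zero (s := Set.Ioi (0 : ℝ))
    isPreconnected_Ioi (fun z hz => (h z hz).differentiableAt.differentiableWithinAt)
    (fun z hz => (h z hz).deriv)
  have : Tendsto f (𝓝[>] 0) (𝓝 a) :=
    tendsto_const_nhds.congr' (by filter_upwards [self_mem_nhdsWithin] with z hz using (ha z hz).symm)
  rw [ha z hz]
  exact tendsto_nhds_unique this hf

/-- A solution of Kummer's equation vanishes if it does so at `0`, together with its Wronskian
with a positive solution. -/
lemma IsKummerSol.eq_zero {p q : ℝ} {w w' v v' : ℝ → ℝ} (h : IsKummerSol p q w w')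
    (k : IsKummerSol p q v v') (hv : ∀ z, 0 < z → 0 < v z)
    (hv0 : Tendsto v (𝓝[>] 0) (𝓝 1)) (hw0 : Tendsto w (𝓝[>] 0) (𝓝 0))
    (hW : Tendsto (fun z => z ^ q * (w z * v' z - w' z * v z)) (𝓝[>] 0) (𝓝 0))
    {z : ℝ} (hz : 0 < z) : w z = 0 := by
  -- Abel's identity: z^q e^(-z) times the Wronskian is constant, and its limit at 0 is 0. Then w/v
  -- has derivative 0 and limit 0.
  have hW0 : ∀ z, 0 < z → w z * v' z - w' z * v z = 0 := by
    intro z hz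
    have := eq_of_hasDerivAt_zero_of_tendsto
      (f := fun z => z ^ q * (w z * v' z - w' z * v z) * Real.exp (-z)) (L := 0) ?_ ?_ hz
    · have h1 : z ^ q ≠ 0 := by positivity
      simpa [h1] using this
    · intro z hz
      have d1 := Real.hasDerivAt_rpow_const (x := z) (p := q) (Or.inl hz.ne')
      have d2 : HasDerivAt (fun z : ℝ => Real.exp (-z)) (Real.exp (-z) * -1) z :=
        (hasDerivAt_id z).neg.exp
      convert! (d1.mul (((h z hz).1.mul (k z hz).2).sub ((h z hz).2.mul (k z hz).1))).mul d2 using 1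
      have : z ^ q = z ^ (q - 1) * z := by
        rw [← Real.rpow_add_one hz.ne']; congr 1; ring
      simp only [Pi.mul_apply, Pi.sub_apply, this]
      field_simp
      ring
    · have h2 : Tendsto (fun z : ℝ => Real.exp (-z)) (𝓝[>] 0) (𝓝 (Real.exp (-0))) :=
        (Continuous.tendsto (by fun_prop) 0).mono_left nhdsWithin_le_nhds
      simpa using hW.mul h2
  have := eq_of_hasDerivAt_zero_of_tendsto (f := fun z => w z / v z) (L := 0) ?_
    (by have := hw0.div hv0 one_ne_zero; rw [zero_div] at this; exact this) hz
  · simpa [(hv z hz).ne'] using this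
  · intro z hz
    convert! (h z hz).1.div (k z hz).1 (hv z hz).ne' using 1
    rw [show w' z * v z - w z * v' z = 0 by linear_combination -hW0 z hz, zero_div]

lemma isKummerSol_shiftedGamma {p q : ℝ} (hp : 0 < p) :
    IsKummerSol p q (fun z => shiftedGamma p (q - p - 1) z 1)
      (fun z => -shiftedGamma (p + 1) (q - p - 1) z 1) := fun z hz => by
  refine ⟨hasDerivAt_shiftedGamma hp hz one_pos, ?_⟩
  convert! (hasDerivAt_shiftedGamma (p := p + 1) (γ := q - p - 1) (by linarith) hz one_pos).neg
    using 1
  have := shiftedGamma_kummer (q := q) hp hz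
  rw [show p + 1 + 1 = p + 2 by ring]
  field_simp
  linear_combination this

lemma isKummerSol_hyp1F1 {p q : ℝ} (hq : ∀ j : ℕ, q + j ≠ 0) :
    IsKummerSol p q (hyp1F1 p q) (hyp1F1Deriv p q) := fun z hz => by
  refine ⟨hasDerivAt_hyp1F1 hq z, ?_⟩
  convert! hasDerivAt_hyp1F1Deriv hq z using 1
  have := hyp1F1_kummer (a := p) hq z
  field_simp
  linear_combination -this

lemma isKummerSol_rpow_mul_hyp1F1 {p q : ℝ} (hq : ∀ j : ℕ, 2 - q + j ≠ 0) :
    IsKummerSol p q (fun z => z ^ (1 - q) * hyp1F1 (p - q + 1) (2 - q) z)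
      (fun z => z ^ (-q) * ((1 - q) * hyp1F1 (p - q + 1) (2 - q) z +
        z * hyp1F1Deriv (p - q + 1) (2 - q) z)) := fun z hz => by
  have hM := hasDerivAt_hyp1F1 (a := p - q + 1) hq z
  have hM' := hasDerivAt_hyp1F1Deriv (a := p - q + 1) hq z
  have hK := hyp1F1_kummer (a := p - q + 1) hq z
  have e1 : z ^ (1 - q) = z ^ (-q) * z := by
    rw [← Real.rpow_add_one hz.ne']; congr 1; ring
  have e2 : z ^ (-q - 1) = z ^ (-q) / z := Real.rpow_sub_one hz.ne' _
  constructor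
  · convert! (Real.hasDerivAt_rpow_const (x := z) (p := 1 - q) (Or.inl hz.ne')).mul hM using 1
    rw [show 1 - q - 1 = -q by ring, e1]
    ring
  · convert! (Real.hasDerivAt_rpow_const (x := z) (p := -q) (Or.inl hz.ne')).mul
      ((hM.const_mul (1 - q)).add ((hasDerivAt_id z).mul hM')) using 1
    simp only [Pi.add_apply, Pi.mul_apply, id, e1, e2]
    field_simp
    linear_combination -z * hK

/-! ### Identification of the integral with Tricomi's function. -/

/-- The linear combination of Kummer functions that defines Tricomi's function. -/
noncomputable def tricomiComb (p q z : ℝ) : ℝ :=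
  Real.Gamma (q - 1) / Real.Gamma p * (z ^ (1 - q) * hyp1F1 (p - q + 1) (2 - q) z)
    + Real.Gamma (1 - q) / Real.Gamma (p - q + 1) * hyp1F1 p q z

/-- For 0 < q < 1 the difference D of the two sides solves Kummer's equation, and the gamma
coefficients are exactly those for which D and z^q D' tend to 0 at 0. So `IsKummerSol.eq_zero`
applies, with ₁F₁(p; q; ·) ≥ 1 as the positive comparison solution. -/
lemma shiftedGamma_div_eq_tricomiComb_of_lt_one {p q z : ℝ} (hp : 0 < p) (hq0 : 0 < q)
    (hq1 : q < 1) (hz : 0 < z) :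
    shiftedGamma p (q - p - 1) z 1 / Real.Gamma p = tricomiComb p q z := by
  have hΓ := Real.Gamma_pos_of_pos hp
  have hq : ∀ j : ℕ, q + j ≠ 0 := fun j => by positivity
  have hq2 : ∀ j : ℕ, 2 - q + j ≠ 0 := fun j => by
    have : (0 : ℝ) ≤ j := j.cast_nonneg
    linarith
  have hV := (isKummerSol_shiftedGamma (q := q) hp).const_mul (Real.Gamma p)⁻¹
  have h2 := (isKummerSol_rpow_mul_hyp1F1 (p := p) hq2).const_mul
    (Real.Gamma (q - 1) / Real.Gamma p)
  have h1 := (isKummerSol_hyp1F1 (p := p) hq).const_mul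
    (Real.Gamma (1 - q) / Real.Gamma (p - q + 1))
  have lim : ∀ {f : ℝ → ℝ}, ContinuousAt f 0 → Tendsto f (𝓝[>] 0) (𝓝 (f 0)) :=
    fun hf => hf.tendsto.mono_left nhdsWithin_le_nhds
  have l1 : Tendsto (hyp1F1 p q) (𝓝[>] 0) (𝓝 1) := by
    simpa [hyp1F1_zero_right] using lim (hasDerivAt_hyp1F1 (a := p) hq 0).continuousAt
  have l1' := lim (hasDerivAt_hyp1F1Deriv (a := p) hq 0).continuousAt
  have l2 : Tendsto (hyp1F1 (p - q + 1) (2 - q)) (𝓝[>] 0) (𝓝 1) := by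
    simpa [hyp1F1_zero_right] using lim (hasDerivAt_hyp1F1 (a := p - q + 1) hq2 0).continuousAt
  have l2' := lim (hasDerivAt_hyp1F1Deriv (a := p - q + 1) hq2 0).continuousAt
  have lpow : ∀ {s : ℝ}, 0 < s → Tendsto (fun z : ℝ => z ^ s) (𝓝[>] 0) (𝓝 0) := fun {s} hs => by
    simpa [Real.zero_rpow hs.ne'] using
      lim (ContinuousAt.rpow_const (f := fun z : ℝ => z) (p := s) continuousAt_id (Or.inr hs.le))
  have lid : Tendsto (fun z : ℝ => z) (𝓝[>] 0) (𝓝 0) := lim continuousAt_id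
  have lV : Tendsto (fun z => shiftedGamma p (q - p - 1) z 1) (𝓝[>] 0)
      (𝓝 (Real.Gamma p * Real.Gamma (1 - q) / Real.Gamma (p - q + 1))) := by
    have := tendsto_shiftedGamma_rate_zero (r := p - q + 1) hp (by linarith)
    rwa [show -(p - q + 1) = q - p - 1 by ring, show p - q + 1 - p = 1 - q by ring] at this
  have lV' : Tendsto (fun z => z ^ q * shiftedGamma (p + 1) (q - p - 1) z 1) (𝓝[>] 0)
      (𝓝 (Real.Gamma q)) := by
    have := tendsto_shiftedGamma_shift_zero (p := p + 1) (γ := q - p - 1) (by linarith)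
      (by linarith)
    rw [show p + 1 + (q - p - 1) = q by ring] at this
    refine this.congr' ?_
    filter_upwards [self_mem_nhdsWithin] with z hz
    have hz' : (0 : ℝ) < z := hz
    rw [shiftedGamma_eq_rpow_mul hz' zero_le_one, ← mul_assoc, ← Real.rpow_add hz', mul_one]
    rw [show q + -(p + 1 + (q - p - 1)) = 0 by ring, Real.rpow_zero, one_mul]
  have lD := ((lV.const_mul (Real.Gamma p)⁻¹).sub
    (((lpow (sub_pos.2 hq1)).mul l2).const_mul (Real.Gamma (q - 1) / Real.Gamma p))).sub
      (l1.const_mul (Real.Gamma (1 - q) / Real.Gamma (p - q + 1)))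
  have eD : (Real.Gamma p)⁻¹ * (Real.Gamma p * Real.Gamma (1 - q) / Real.Gamma (p - q + 1)) -
      Real.Gamma (q - 1) / Real.Gamma p * (0 * 1) -
      Real.Gamma (1 - q) / Real.Gamma (p - q + 1) * 1 = 0 := by
    field_simp
    ring
  rw [eD] at lD
  have lD' := ((lV'.const_mul (-(Real.Gamma p)⁻¹)).sub
    (((l2.const_mul (1 - q)).add (lid.mul l2')).const_mul (Real.Gamma (q - 1) / Real.Gamma p))).sub
      (((lpow hq0).mul l1').const_mul (Real.Gamma (1 - q) / Real.Gamma (p - q + 1)))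
  -- The z^(-q) singularities of the derivatives cancel because (q-1)Γ(q-1) = Γ(q).
  have eD' : -(Real.Gamma p)⁻¹ * Real.Gamma q - Real.Gamma (q - 1) / Real.Gamma p *
      ((1 - q) * 1 + 0 * hyp1F1Deriv (p - q + 1) (2 - q) 0) -
      Real.Gamma (1 - q) / Real.Gamma (p - q + 1) * (0 * hyp1F1Deriv p q 0) = 0 := by
    have := Real.Gamma_add_one (s := q - 1) (by linarith)
    rw [sub_add_cancel] at this
    rw [this]
    field_simp
    ring
  rw [eD'] at lD'
  have key := ((hV.sub h2).sub h1).eq_zero (isKummerSol_hyp1F1 hq)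
    (fun z hz => one_pos.trans_le (one_le_hyp1F1 hp hq0 hz)) l1 lD ?_ hz
  · unfold tricomiComb
    linear_combination key
  · have := (((lpow hq0).mul lD).mul l1').sub (lD'.mul l1)
    simp only [zero_mul, sub_zero] at this
    refine this.congr' ?_
    filter_upwards [self_mem_nhdsWithin] with z hz
    have hz' : (0 : ℝ) < z := hz
    have : z ^ q * z ^ (-q) = 1 := by rw [← Real.rpow_add hz']; simp
    linear_combination (-(Real.Gamma (q - 1) / Real.Gamma p * ((1 - q) *
      hyp1F1 (p - q + 1) (2 - q) z + z * hyp1F1Deriv (p - q + 1) (2 - q) z)) *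
      hyp1F1 p q z) * this

lemma shiftedGamma_add_one {p γ z : ℝ} (hp : 0 < p) (hz : 0 < z) :
    shiftedGamma p (γ + 1) z 1 = shiftedGamma p γ z 1 + shiftedGamma (p + 1) γ z 1 := by
  unfold shiftedGamma
  rw [← integral_add (integrableOn_shiftedGamma hp hz (Or.inl one_pos))
    (integrableOn_shiftedGamma (by linarith) hz (Or.inl one_pos))]
  refine setIntegral_congr_fun measurableSet_Ioi fun t ht => ?_
  have ht' : (0 : ℝ) < t := ht
  have e1 : t ^ (p + 1 - 1) = t ^ (p - 1) * t := by
    rw [← Real.rpow_add_one ht'.ne']; congr 1; ring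
  simp only [e1, Real.rpow_add_one (by linarith : 1 + t ≠ 0)]
  ring

/-- Write V_q for the integral as a function of the rate z. Then V_(q+1) = V_q - V_q', since
multiplying the integrand by 1+t adds minus the derivative in z. The Kummer combination obeys the
same recursion by the two contiguous relations. -/
lemma shiftedGamma_div_eq_tricomiComb_of_floor (N : ℕ) {p q z : ℝ} (hp : 0 < p) (hq0 : N < q)
    (hq1 : q < N + 1) (hz : 0 < z) :
    shiftedGamma p (q - p - 1) z 1 / Real.Gamma p = tricomiComb p q z := by
  induction N generalizing q z with
  | zero =>
    exact shiftedGamma_div_eq_tricomiComb_of_lt_one hp (by simpa using hq0) (by simpa using hq1) hz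
  | succ N ih =>
    push_cast at hq0 hq1
    have hN : (0 : ℝ) ≤ N := N.cast_nonneg
    obtain ⟨q, rfl⟩ : ∃ q', q = q' + 1 := ⟨q - 1, by ring⟩
    have hq : ∀ j : ℕ, q + j ≠ 0 := fun j => by
      have : (0 : ℝ) ≤ j := j.cast_nonneg
      linarith
    have hq2 : ∀ j : ℕ, 1 - q + j ≠ 0 := fun j h => by
      have h1 : (N : ℝ) < j + 1 := by linarith
      have h2 : (j + 1 : ℝ) < N + 1 := by linarith
      norm_cast at h1 h2
      lia
    have hq3 : ∀ j : ℕ, 2 - q + j ≠ 0 := fun j h => hq2 (j + 1) (by push_cast; linarith)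
    have hd1 := ((isKummerSol_shiftedGamma (q := q) hp).const_mul (Real.Gamma p)⁻¹ z hz).1
    have hd2 := ((isKummerSol_rpow_mul_hyp1F1 (p := p) hq3).const_mul
      (Real.Gamma (q - 1) / Real.Gamma p) z hz).1.add (((isKummerSol_hyp1F1 (p := p) hq).const_mul
      (Real.Gamma (1 - q) / Real.Gamma (p - q + 1))) z hz).1
    have hd := hd1.unique (hd2.congr_of_eventuallyEq (by
      filter_upwards [Ioi_mem_nhds hz] with y hy
      rw [inv_mul_eq_div]
      exact ih (by linarith) (by linarith) hy))
    have hv := ih (q := q) (by linarith) (by linarith) hz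
    have c1 := hyp1F1_sub_deriv (a := p) hq z
    have c2 := hyp1F1_contiguous (a := p - q + 1) (s := 1 - q) hq2 z
    rw [show 1 - q + 1 = 2 - q by ring, show p - q + 1 - 1 = p - q by ring] at c2
    have e1 : z ^ (1 - q) = z ^ (-q) * z := by
      rw [← Real.rpow_add_one hz.ne']; congr 1; ring
    have g1 := Real.Gamma_add_one (s := q - 1) (fun h => hq2 0 (by push_cast; linarith))
    rw [sub_add_cancel] at g1
    have hq0' : q ≠ 0 := by simpa using hq 0
    have g2 : Real.Gamma (1 - q) / Real.Gamma (p - q + 1) * ((q - p) / q) =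
        Real.Gamma (-q) / Real.Gamma (p - q) := by
      have := Real.Gamma_add_one (s := -q) (neg_ne_zero.2 hq0')
      rw [show -q + 1 = 1 - q by ring] at this
      rw [this]
      -- For p = q both sides are 0, the right one because `Real.Gamma 0 = 0`.
      rcases eq_or_ne p q with rfl | hpq
      · simp
      · have hpq' : p - q ≠ 0 := sub_ne_zero.2 hpq
        rw [Real.Gamma_add_one hpq']
        field_simp
        ring
    rw [show q + 1 - p - 1 = q - p - 1 + 1 by ring, shiftedGamma_add_one hp hz]
    simp only [tricomiComb] at hv ⊢
    rw [show q + 1 - 1 = q by ring, show 1 - (q + 1) = -q by ring,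
      show p - (q + 1) + 1 = p - q by ring, show 2 - (q + 1) = 1 - q by ring, ← g2, g1]
    rw [e1] at hv
    linear_combination hv - hd - Real.Gamma (q - 1) / Real.Gamma p * z ^ (-q) * c2 +
      Real.Gamma (1 - q) / Real.Gamma (p - q + 1) * c1

/-- This uses Kummer's transformation U(a, b, z) = z^(1-b) U(a-b+1, 2-b, z). The integral needs a
positive first parameter, and in the application a = 1 - α may be negative while a - b + 1 is
positive. -/
lemma tricomiUNonint_eq {a b z : ℝ} (hb : b < 2) (hb' : ∀ m : ℤ, (m : ℝ) ≠ b) (hab : 0 < a - b + 1)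
    (hz : 0 < z) :
    tricomiUNonint a b z = shiftedGamma (a - b + 1) (-a) 1 z / Real.Gamma (a - b + 1) := by
  have h0 : ((⌊2 - b⌋₊ : ℕ) : ℝ) < 2 - b := by
    refine lt_of_le_of_ne (Nat.floor_le (by linarith)) fun h => ?_
    exact hb' (2 - ⌊2 - b⌋₊) (by push_cast; linarith)
  have h := shiftedGamma_div_eq_tricomiComb_of_floor ⌊2 - b⌋₊ hab h0
    (by exact_mod_cast Nat.lt_floor_add_one (2 - b)) hz
  rw [show 2 - b - (a - b + 1) - 1 = -a by ring,
    shiftedGamma_eq_rpow_mul hz zero_le_one, mul_one,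
    show -(a - b + 1 + -a) = b - 1 by ring] at h
  have e : z ^ (1 - b) * z ^ (b - 1) = 1 := by rw [← Real.rpow_add hz]; simp
  have h2 := congrArg (fun x => z ^ (1 - b) * x) h
  simp only [tricomiComb, show 1 - (2 - b) = b - 1 by ring, show 2 - (2 - b) = b by ring,
    show 2 - b - 1 = 1 - b by ring, show a - b + 1 - (2 - b) + 1 = a by ring] at h2
  unfold tricomiUNonint
  linear_combination (shiftedGamma (a - b + 1) (-a) 1 z / Real.Gamma (a - b + 1) -
    Real.Gamma (1 - b) / Real.Gamma (a - b + 1) * hyp1F1 a b z) * e - h2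

/-- The integral representation of Tricomi's function for an integer second parameter. -/
lemma tricomiU_eq {α β z : ℝ} {m : ℕ} (hβ : 0 < β) (hm : α + β = m)
    (h : (0 < z ∧ 1 ≤ m) ∨ (z = 0 ∧ 2 ≤ m)) :
    tricomiU (1 - α) (2 - α - β) z = shiftedGamma β (α - 1) 1 z / Real.Gamma β := by
  have hb : 2 - α - β = 2 - (m : ℝ) := by linarith
  have hΓ : ContinuousAt Real.Gamma β := (Real.differentiableAt_Gamma fun k => by
    have : (0 : ℝ) ≤ k := k.cast_nonneg
    linarith).continuousAt
  have hΓ0 := (Real.Gamma_pos_of_pos hβ).ne'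
  have hs : Tendsto (fun b : ℝ => 1 - α - b + 1) (𝓝[≠] (2 - α - β)) (𝓝 β) := by
    have : ContinuousAt (fun b : ℝ => 1 - α - b + 1) (2 - α - β) := by fun_prop
    have h := this.tendsto
    rw [show 1 - α - (2 - α - β) + 1 = β by ring] at h
    exact h.mono_left nhdsWithin_le_nhds
  rw [tricomiU, if_pos ⟨2 - m, by push_cast; linarith⟩]
  refine Tendsto.limUnder_eq ?_
  rcases h with ⟨hz, hm1⟩ | ⟨rfl, hm2⟩
  · have hlim := (((continuousAt_shiftedGamma_left (γ := α - 1) hβ one_pos hz).tendsto.comp hs).div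
      (hΓ.tendsto.comp hs) hΓ0)
    refine hlim.congr' ?_
    -- Within this radius the centre is the only integer, and the first parameter of the integral
    -- stays positive.
    have hr : 0 < min (1 / 2) β := by positivity
    filter_upwards [self_mem_nhdsWithin, mem_nhdsWithin_of_mem_nhds
      (Ioo_mem_nhds (sub_lt_self _ hr) (lt_add_of_pos_right _ hr))] with b hb1 hb2
    have hm1' : (1 : ℝ) ≤ m := by exact_mod_cast hm1
    have h1 := min_le_left (1 / 2) β
    have h2 := min_le_right (1 / 2) β
    have hb3 := hb2.1
    have hb4 := hb2.2
    rw [tricomiUNonint_eq (by linarith) _ (by linarith) hz, neg_sub]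
    · rfl
    · rintro k rfl
      apply hb1
      have h3 : (2 : ℝ) - m - 1 < k := by linarith
      have h4 : (k : ℝ) < 2 - m + 1 := by linarith
      rw [Set.mem_singleton_iff, hb]
      have h3' : ((2 - m - 1 : ℤ) : ℝ) < k := by push_cast; exact h3
      have h4' : (k : ℝ) < ((2 - m + 1 : ℤ) : ℝ) := by push_cast; exact h4
      norm_cast at h3' h4'
      have h5 : k = 2 - m := by lia
      rw [h5]; push_cast; rfl
  · have hm2' : (2 : ℝ) ≤ m := by exact_mod_cast hm2
    have hS : shiftedGamma β (α - 1) 1 0 = Real.Gamma (m - 1) := by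
      unfold shiftedGamma
      have := Real.integral_rpow_mul_exp_neg_mul_Ioi (a := m - 1) (r := 1) (by linarith) one_pos
      rw [div_one, Real.one_rpow, one_mul] at this
      rw [← this]
      refine setIntegral_congr_fun measurableSet_Ioi fun t ht => ?_
      have ht' : (0 : ℝ) < t := ht
      simp only [zero_add]
      rw [← Real.rpow_add ht', ← hm]
      congr 2; ring
    have hs1 : Tendsto (fun b : ℝ => 1 - b) (𝓝[≠] (2 - α - β)) (𝓝 (m - 1)) := by
      have : ContinuousAt (fun b : ℝ => 1 - b) (2 - α - β) := by fun_prop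
      have h := this.tendsto
      rw [show 1 - (2 - α - β) = m - 1 by linarith] at h
      exact h.mono_left nhdsWithin_le_nhds
    have hΓ1 : ContinuousAt Real.Gamma (m - 1) := (Real.differentiableAt_Gamma fun k => by
      have : (0 : ℝ) ≤ k := k.cast_nonneg
      linarith).continuousAt
    rw [hS]
    refine ((hΓ1.tendsto.comp hs1).div (hΓ.tendsto.comp hs) hΓ0).congr' ?_
    -- Near the limit 1 - b is positive, so 0^(1-b) = 0 and only the second Kummer series
    -- contributes, with value Γ(1-b)/Γ(a-b+1) at 0.
    filter_upwards [mem_nhdsWithin_of_mem_nhds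
      (Iio_mem_nhds (lt_add_of_pos_right (2 - α - β) (half_pos one_pos)))] with b hb2
    have hb3 : b < 2 - α - β + 1 / 2 := hb2
    have : (0 : ℝ) ^ (1 - b) = 0 := Real.zero_rpow (by linarith)
    simp [tricomiUNonint, this, hyp1F1_zero_right]

/-! ### Laws determined by their moment generating functions -/

/-- The moment generating function of a measure on the line, with values in `[0, ∞]`. -/
noncomputable def lintegralExp (μ : Measure ℝ) (t : ℝ) : ENNReal :=
  ∫⁻ x, ENNReal.ofReal (Real.exp (t * x)) ∂μ

lemma integrable_exp_of_lintegralExp_lt_top {μ : Measure ℝ} {t : ℝ}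
    (h : lintegralExp μ t < ⊤) : Integrable (fun x => Real.exp (t * x)) μ :=
  ⟨by fun_prop, (hasFiniteIntegral_iff_ofReal (ae_of_all _ fun _ => (Real.exp_pos _).le)).2 h⟩

lemma mgf_id_eq_toReal_lintegralExp (μ : Measure ℝ) (t : ℝ) :
    mgf id μ t = (lintegralExp μ t).toReal := by
  rw [mgf, integral_eq_lintegral_of_nonneg_ae (ae_of_all _ fun _ => (Real.exp_pos _).le)
    (by fun_prop)]
  rfl

/-- Both complex moment generating functions are analytic on the strip |Re z| < ε and agree on a
real interval, hence on the imaginary axis, where they are the characteristic functions. Values in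
[0, ∞] transfer finiteness to ν, and t = 0 gives its total mass. -/
lemma ext_of_lintegralExp {μ ν : Measure ℝ} [IsProbabilityMeasure μ] {ε : ℝ} (hε : 0 < ε)
    (h : ∀ t, |t| < ε → lintegralExp μ t = lintegralExp ν t)
    (hfin : ∀ t, |t| < ε → lintegralExp μ t < ⊤) : μ = ν := by
  have hν : IsProbabilityMeasure ν := by
    have := h 0 (by simpa using hε)
    simp only [lintegralExp, zero_mul, Real.exp_zero, ENNReal.ofReal_one, lintegral_one,
      measure_univ] at this
    exact ⟨this.symm⟩
  have hsub : ∀ {κ : Measure ℝ}, (∀ t, |t| < ε → lintegralExp κ t < ⊤) →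
      {z : ℂ | z.re ∈ Set.Ioo (-ε) ε} ⊆ {z | z.re ∈ interior (integrableExpSet id κ)} := by
    intro κ hκ z hz
    refine interior_maximal (fun t ht => ?_) isOpen_Ioo hz
    exact integrable_exp_of_lintegralExp_lt_top (hκ t (abs_lt.2 ht))
  have hX : AnalyticOnNhd ℂ (complexMGF id μ) {z : ℂ | z.re ∈ Set.Ioo (-ε) ε} :=
    analyticOnNhd_complexMGF.mono (hsub hfin)
  have hY : AnalyticOnNhd ℂ (complexMGF id ν) {z : ℂ | z.re ∈ Set.Ioo (-ε) ε} :=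
    analyticOnNhd_complexMGF.mono (hsub fun t ht => h t ht ▸ hfin t ht)
  have key : Set.EqOn (complexMGF id μ) (complexMGF id ν) {z : ℂ | z.re ∈ Set.Ioo (-ε) ε} := by
    refine hX.eqOn_of_preconnected_of_frequently_eq hY
      (((convex_Ioo (-ε) ε).linear_preimage Complex.reLm).isPreconnected)
      (z₀ := ((0 : ℝ) : ℂ)) (by simpa using hε) ?_
    have h_real : ∃ᶠ (x : ℝ) in 𝓝[≠] 0, complexMGF id μ x = complexMGF id ν x := by
      refine Eventually.frequently ?_
      filter_upwards [mem_nhdsWithin_of_mem_nhds (Ioo_mem_nhds (neg_lt_zero.2 hε) hε)] with y hy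
      rw [complexMGF_ofReal, complexMGF_ofReal, mgf_id_eq_toReal_lintegralExp,
        mgf_id_eq_toReal_lintegralExp, h y (abs_lt.2 hy)]
    rw [frequently_iff_seq_forall] at h_real ⊢
    obtain ⟨xs, hx_tendsto, hx_eq⟩ := h_real
    refine ⟨fun n => xs n, ?_, fun n => by simp [hx_eq]⟩
    rw [tendsto_nhdsWithin_iff] at hx_tendsto ⊢
    constructor
    · exact (Complex.continuous_ofReal.tendsto 0).comp hx_tendsto.1
    · simpa using hx_tendsto.2
  refine Measure.ext_of_charFun (funext fun t => ?_)
  rw [← complexMGF_id_mul_I, ← complexMGF_id_mul_I]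
  exact key (by simpa using hε)

/-! ### Exponential moments of squared normals, gamma mixtures and differences. -/

lemma lintegral_exp_sq_gaussianReal (m : ℝ) {v : NNReal} (hv : v ≠ 0) {t : ℝ}
    (ht : 2 * v * t < 1) :
    ∫⁻ x, ENNReal.ofReal (Real.exp (t * x ^ 2)) ∂gaussianReal m v =
      ENNReal.ofReal ((1 - 2 * v * t) ^ (-(1 / 2) : ℝ) *
        Real.exp (m ^ 2 * t / (1 - 2 * v * t))) := by
  have hd : 0 < 1 - 2 * v * t := by linarith
  set d : ℝ := 1 - 2 * v * t with hd_def
  have hv' : (0 : ℝ) < v := by positivity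
  have hw : v / d.toNNReal ≠ 0 := div_ne_zero hv (by simpa using hd)
  -- Completing the square: the tilted density is a multiple of that of N(m/d, v/d).
  have hpt : ∀ x, gaussianPDF m v x * ENNReal.ofReal (Real.exp (t * x ^ 2)) =
      ENNReal.ofReal (d ^ (-(1 / 2) : ℝ) * Real.exp (m ^ 2 * t / d)) *
        gaussianPDF (m / d) (v / d.toNNReal) x := by
    intro x
    rw [gaussianPDF, gaussianPDF, ← ENNReal.ofReal_mul (gaussianPDFReal_nonneg _ _ _),
      ← ENNReal.ofReal_mul (by positivity)]
    congr 1
    have e1 : ((v / d.toNNReal : NNReal) : ℝ) = v / d := by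
      rw [NNReal.coe_div, Real.coe_toNNReal _ hd.le]
    have e2 : (√(2 * Real.pi * (v / d)))⁻¹ = (√(2 * Real.pi * v))⁻¹ * √d := by
      rw [← mul_div_assoc, Real.sqrt_div' _ hd.le]
      field_simp
    have e3 : d ^ (-(1 / 2) : ℝ) * √d = 1 := by
      rw [Real.sqrt_eq_rpow, ← Real.rpow_add hd]; simp
    have e4 : Real.exp (-(x - m) ^ 2 / (2 * v)) * Real.exp (t * x ^ 2) =
        Real.exp (m ^ 2 * t / d) * Real.exp (-(x - m / d) ^ 2 / (2 * (v / d))) := by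
      rw [← Real.exp_add, ← Real.exp_add]
      congr 1
      have ht' : t = (1 - d) / (2 * v) := by rw [hd_def]; field_simp; ring
      rw [ht']
      field_simp
      ring
    simp only [gaussianPDFReal, e1, e2]
    linear_combination (√(2 * Real.pi * v))⁻¹ * e4 - (√(2 * Real.pi * v))⁻¹ *
      Real.exp (m ^ 2 * t / d) * Real.exp (-(x - m / d) ^ 2 / (2 * (v / d))) * e3
  rw [gaussianReal_of_var_ne_zero _ hv,
    lintegral_withDensity_eq_lintegral_mul _ (by fun_prop) (by fun_prop)]
  simp only [Pi.mul_apply, hpt]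
  rw [lintegral_const_mul _ (by fun_prop), lintegral_gaussianPDF_eq_one _ hw, mul_one]

@[fun_prop]
lemma measurable_gammaPDF (a r : ℝ) : Measurable (gammaPDF a r) :=
  (measurable_gammaPDFReal a r).ennreal_ofReal

lemma lintegral_exp_mul_gammaPDF {a r t : ℝ} (ha : 0 < a) (hr : 0 < r) (ht : t < r) :
    ∫⁻ x, ENNReal.ofReal (Real.exp (t * x)) * gammaPDF a r x =
      ENNReal.ofReal ((r / (r - t)) ^ a) := by
  have hrt : 0 < r - t := sub_pos.2 ht
  -- Exponential tilting only lowers the rate from r to r - t.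
  have hpt : ∀ x, ENNReal.ofReal (Real.exp (t * x)) * gammaPDF a r x =
      ENNReal.ofReal ((r / (r - t)) ^ a) * gammaPDF a (r - t) x := by
    intro x
    rw [gammaPDF, gammaPDF, ← ENNReal.ofReal_mul (Real.exp_pos _).le,
      ← ENNReal.ofReal_mul (by positivity)]
    congr 1
    unfold gammaPDFReal
    split_ifs
    · have : Real.exp (-((r - t) * x)) = Real.exp (t * x) * Real.exp (-(r * x)) := by
        rw [← Real.exp_add]; congr 1; ring
      rw [this, Real.div_rpow hr.le hrt.le]
      have : (r - t) ^ a ≠ 0 := by positivity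
      field_simp
    · simp
  simp_rw [hpt]
  rw [lintegral_const_mul _ (by fun_prop), lintegral_gammaPDF_eq_one ha hrt, mul_one]

/-- The weights of the Poisson distribution. -/
noncomputable def poissonWeight (l : ℝ) (i : ℕ) : ℝ := Real.exp (-l) * l ^ i / i.factorial

lemma poissonWeight_nonneg {l : ℝ} (hl : 0 ≤ l) (i : ℕ) : 0 ≤ poissonWeight l i := by
  unfold poissonWeight; positivity

lemma hasSum_poissonWeight_mul_pow (l u : ℝ) :
    HasSum (fun i => poissonWeight l i * u ^ i) (Real.exp (l * (u - 1))) := by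
  have := (NormedSpace.expSeries_div_hasSum_exp (l * u)).mul_left (Real.exp (-l))
  rw [← Real.exp_eq_exp_ℝ, ← Real.exp_add] at this
  convert! this using 1
  · funext i
    rw [poissonWeight, mul_pow]; ring
  · congr 1; ring

/-- The density of a Poisson mixture of gamma distributions. -/
noncomputable def gammaMixture (l a r x : ℝ) : ENNReal :=
  ∑' i : ℕ, ENNReal.ofReal (poissonWeight l i) * gammaPDF (a + i) r x

@[fun_prop]
lemma measurable_gammaMixture (l a r : ℝ) : Measurable (gammaMixture l a r) :=
  Measurable.tsum fun _ => by fun_prop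

/-- With u = r/(r-t), component i contributes u^(a+i), and the Poisson weights sum u^i to
exp(l(u-1)). This is the form taken by powers of the moment generating function of a squared normal.
-/
lemma lintegral_exp_mul_gammaMixture {l a r t : ℝ} (hl : 0 ≤ l) (ha : 0 < a) (hr : 0 < r)
    (ht : t < r) :
    ∫⁻ x, ENNReal.ofReal (Real.exp (t * x)) * gammaMixture l a r x =
      ENNReal.ofReal ((r / (r - t)) ^ a * Real.exp (l * (r / (r - t) - 1))) := by
  have hu : 0 < r / (r - t) := div_pos hr (sub_pos.2 ht)
  simp_rw [gammaMixture, ← ENNReal.tsum_mul_left]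
  rw [lintegral_tsum fun _ => by fun_prop]
  have hi : ∀ i : ℕ, ∫⁻ x, ENNReal.ofReal (Real.exp (t * x)) *
      (ENNReal.ofReal (poissonWeight l i) * gammaPDF (a + i) r x) =
      ENNReal.ofReal ((r / (r - t)) ^ a * (poissonWeight l i * (r / (r - t)) ^ i)) := by
    intro i
    simp_rw [mul_left_comm _ (ENNReal.ofReal (poissonWeight l i))]
    rw [lintegral_const_mul _ (by fun_prop), lintegral_exp_mul_gammaPDF (by positivity) hr ht,
      ← ENNReal.ofReal_mul (poissonWeight_nonneg hl i), Real.rpow_add hu, Real.rpow_natCast]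
    congr 1; ring
  simp_rw [hi]
  have hs := (hasSum_poissonWeight_mul_pow l (r / (r - t))).mul_left ((r / (r - t)) ^ a)
  rw [← hs.tsum_eq, ENNReal.ofReal_tsum_of_nonneg _ hs.summable]
  intro i
  have := poissonWeight_nonneg hl i
  positivity

/-- The density of the difference of two independent variables with densities `F` and `G`. -/
noncomputable def diffDensity (F G : ℝ → ENNReal) (x : ℝ) : ENNReal := ∫⁻ y, F (x + y) * G y

lemma lintegralExp_withDensity_diffDensity {F G : ℝ → ENNReal} (hF : Measurable F)
    (hG : Measurable G) (t : ℝ) :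
    lintegralExp (volume.withDensity (diffDensity F G)) t =
      (∫⁻ x, ENNReal.ofReal (Real.exp (t * x)) * F x) *
        ∫⁻ y, ENNReal.ofReal (Real.exp (-t * y)) * G y := by
  have hm : Measurable (diffDensity F G) :=
    Measurable.lintegral_prod_right' (f := fun p : ℝ × ℝ => F (p.1 + p.2) * G p.2) (by fun_prop)
  rw [lintegralExp, lintegral_withDensity_eq_lintegral_mul _ hm (by fun_prop)]
  simp only [Pi.mul_apply, diffDensity]
  have h1 : ∀ x, (∫⁻ y, F (x + y) * G y) * ENNReal.ofReal (Real.exp (t * x)) =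
      ∫⁻ y, (ENNReal.ofReal (Real.exp (t * (x + y))) * F (x + y)) *
        (ENNReal.ofReal (Real.exp (-t * y)) * G y) := by
    intro x
    rw [← lintegral_mul_const _ (by fun_prop)]
    refine lintegral_congr fun y => ?_
    have : Real.exp (t * x) = Real.exp (t * (x + y)) * Real.exp (-t * y) := by
      rw [← Real.exp_add]; congr 1; ring
    rw [this, ENNReal.ofReal_mul (Real.exp_pos _).le]
    ring
  simp_rw [h1]
  rw [lintegral_lintegral_swap (by fun_prop)]
  have h2 : ∀ y, ∫⁻ x, (ENNReal.ofReal (Real.exp (t * (x + y))) * F (x + y)) *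
        (ENNReal.ofReal (Real.exp (-t * y)) * G y) =
      (∫⁻ x, ENNReal.ofReal (Real.exp (t * x)) * F x) *
        (ENNReal.ofReal (Real.exp (-t * y)) * G y) := by
    intro y
    rw [lintegral_mul_const _ (by fun_prop),
      lintegral_add_right_eq_self (fun x => ENNReal.ofReal (Real.exp (t * x)) * F x) y]
  simp_rw [h2]
  rw [lintegral_const_mul _ (by fun_prop)]

/-! ### Sums of products of correlated normal variables -/

lemma posSemidef_covariance (σX σY : ℝ) {ρ : ℝ} (hρ : ρ ∈ Set.Ioo (-1 : ℝ) 1) :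
    (!![σX ^ 2, ρ * σX * σY; ρ * σX * σY, σY ^ 2] : Matrix (Fin 2) (Fin 2) ℝ).PosSemidef := by
  refine Matrix.PosSemidef.of_dotProduct_mulVec_nonneg ?_ fun x => ?_
  · ext i j
    fin_cases i <;> fin_cases j <;> simp [Matrix.conjTranspose]
  -- The quadratic form is half the sum of these two squares.
  · have h1 : 0 ≤ (1 + ρ) * (x 0 * σX + x 1 * σY) ^ 2 :=
      mul_nonneg (by linarith [hρ.1]) (sq_nonneg _)
    have h2 : 0 ≤ (1 - ρ) * (x 0 * σX - x 1 * σY) ^ 2 :=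
      mul_nonneg (by linarith [hρ.2]) (sq_nonneg _)
    simp only [star_trivial, Matrix.mulVec, dotProduct, Fin.sum_univ_two, Matrix.of_apply,
      Matrix.cons_val_zero, Matrix.cons_val_one, Matrix.cons_val_fin_one]
    linarith

/-- A bivariate normal vector is a linear image of two independent normal variables. -/
lemma bivariateNormal_eq_map (μX μY : ℝ) {σX σY ρ : ℝ} (hσX : 0 < σX) (hσY : 0 < σY)
    (hρ : ρ ∈ Set.Ioo (-1 : ℝ) 1) :
    bivariateNormal μX μY σX σY ρ =
      ((gaussianReal (μX / σX + μY / σY) (2 * (1 + ρ)).toNNReal).prod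
        (gaussianReal (μX / σX - μY / σY) (2 * (1 - ρ)).toNNReal)).map
        (fun p : ℝ × ℝ => !₂[σX * (p.1 + p.2) / 2, σY * (p.1 - p.2) / 2]) := by
  have hm : Measurable (fun p : ℝ × ℝ => !₂[σX * (p.1 + p.2) / 2, σY * (p.1 - p.2) / 2]) := by
    fun_prop
  have : IsFiniteMeasure (bivariateNormal μX μY σX σY ρ) := by
    unfold bivariateNormal; infer_instance
  refine Measure.ext_of_charFun (funext fun ξ => ?_)
  rw [bivariateNormal, charFun_multivariateGaussian (posSemidef_covariance σX σY hρ),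
    charFun_apply, integral_map hm.aemeasurable (by fun_prop)]
  have h1 : ∀ p : ℝ × ℝ, Complex.exp
      (inner ℝ !₂[σX * (p.1 + p.2) / 2, σY * (p.1 - p.2) / 2] ξ * Complex.I) =
      Complex.exp (((ξ 0 * σX + ξ 1 * σY) / 2 : ℝ) * p.1 * Complex.I) *
        Complex.exp (((ξ 0 * σX - ξ 1 * σY) / 2 : ℝ) * p.2 * Complex.I) := by
    intro p
    rw [← Complex.exp_add]
    congr 1
    simp only [PiLp.inner_apply, Fin.sum_univ_two, RCLike.inner_apply, conj_trivial]
    simp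
    ring
  simp_rw [h1]
  rw [integral_prod_mul (fun a : ℝ => Complex.exp (((ξ 0 * σX + ξ 1 * σY) / 2 : ℝ) * a * Complex.I))
    (fun b : ℝ => Complex.exp (((ξ 0 * σX - ξ 1 * σY) / 2 : ℝ) * b * Complex.I)),
    ← charFun_apply_real, ← charFun_apply_real, charFun_gaussianReal, charFun_gaussianReal,
    ← Complex.exp_add]
  congr 1
  rw [Real.coe_toNNReal _ (by linarith [hρ.1]), Real.coe_toNNReal _ (by linarith [hρ.2])]
  simp only [PiLp.inner_apply, Fin.sum_univ_two, RCLike.inner_apply, conj_trivial,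
    Matrix.mulVec, dotProduct, Matrix.of_apply,
      Matrix.cons_val_zero, Matrix.cons_val_one, Matrix.cons_val_fin_one]
  have e1 : (σX : ℂ) ≠ 0 := by exact_mod_cast hσX.ne'
  have e2 : (σY : ℂ) ≠ 0 := by exact_mod_cast hσY.ne'
  push_cast
  field_simp
  ring

lemma lintegral_exp_mul_bivariateNormal (μX μY : ℝ) {σX σY ρ t : ℝ} (hσX : 0 < σX) (hσY : 0 < σY)
    (hρ : ρ ∈ Set.Ioo (-1 : ℝ) 1) (h1 : (1 + ρ) * (σX * σY * t) < 1)
    (h2 : (1 - ρ) * (σX * σY * -t) < 1) :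
    ∫⁻ v : EuclideanSpace ℝ (Fin 2), ENNReal.ofReal (Real.exp (t * (v 0 * v 1)))
        ∂bivariateNormal μX μY σX σY ρ =
      ENNReal.ofReal ((1 - (1 + ρ) * (σX * σY * t)) ^ (-(1 / 2) : ℝ) *
        Real.exp ((μX / σX + μY / σY) ^ 2 * (σX * σY * t / 4) / (1 - (1 + ρ) * (σX * σY * t)))) *
      ENNReal.ofReal ((1 - (1 - ρ) * (σX * σY * -t)) ^ (-(1 / 2) : ℝ) *
        Real.exp ((μX / σX - μY / σY) ^ 2 * (σX * σY * -t / 4) /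
          (1 - (1 - ρ) * (σX * σY * -t)))) := by
  have hm : Measurable (fun p : ℝ × ℝ => !₂[σX * (p.1 + p.2) / 2, σY * (p.1 - p.2) / 2]) := by
    fun_prop
  have p1 : 0 < 2 * (1 + ρ) := by linarith [hρ.1]
  have p2 : 0 < 2 * (1 - ρ) := by linarith [hρ.2]
  rw [bivariateNormal_eq_map μX μY hσX hσY hρ, lintegral_map (by fun_prop) hm]
  have hpt : ∀ p : ℝ × ℝ, ENNReal.ofReal (Real.exp (t *
      ((!₂[σX * (p.1 + p.2) / 2, σY * (p.1 - p.2) / 2] : EuclideanSpace ℝ (Fin 2)) 0 *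
      (!₂[σX * (p.1 + p.2) / 2, σY * (p.1 - p.2) / 2] : EuclideanSpace ℝ (Fin 2)) 1))) =
      ENNReal.ofReal (Real.exp (σX * σY * t / 4 * p.1 ^ 2)) *
        ENNReal.ofReal (Real.exp (σX * σY * -t / 4 * p.2 ^ 2)) := by
    intro p
    rw [← ENNReal.ofReal_mul (Real.exp_pos _).le, ← Real.exp_add]
    congr 2
    simp
    ring
  simp_rw [hpt]
  rw [lintegral_prod_mul (f := fun a : ℝ => ENNReal.ofReal (Real.exp (σX * σY * t / 4 * a ^ 2)))
    (g := fun b : ℝ => ENNReal.ofReal (Real.exp (σX * σY * -t / 4 * b ^ 2)))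
    (by fun_prop) (by fun_prop)]
  have e1 : 1 - 2 * ((2 * (1 + ρ)).toNNReal : ℝ) * (σX * σY * t / 4) =
      1 - (1 + ρ) * (σX * σY * t) := by rw [Real.coe_toNNReal _ p1.le]; ring
  have e2 : 1 - 2 * ((2 * (1 - ρ)).toNNReal : ℝ) * (σX * σY * -t / 4) =
      1 - (1 - ρ) * (σX * σY * -t) := by rw [Real.coe_toNNReal _ p2.le]; ring
  rw [lintegral_exp_sq_gaussianReal _ (by simpa using p1) (by linarith),
    lintegral_exp_sq_gaussianReal _ (by simpa using p2) (by linarith), e1, e2]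

/-- Independence factorises the exponential of the sum. The variables are only almost everywhere
measurable, so they are first replaced by measurable versions. -/
lemma lintegralExp_map_sum {Ω : Type*} [MeasurableSpace Ω] {P : Measure Ω} {n : ℕ}
    {Z : Fin n → Ω → ℝ} {κ : Measure ℝ} (hZ : ∀ i, AEMeasurable (Z i) P)
    (hκ : ∀ i, P.map (Z i) = κ) (hindep : iIndepFun Z P) (t : ℝ) :
    lintegralExp (P.map fun ω => ∑ i, Z i ω) t = lintegralExp κ t ^ n := by
  have hmk : iIndepFun (fun i => (hZ i).mk) P := hindep.congr fun i => (hZ i).ae_eq_mk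
  have hexp : iIndepFun (fun i ω => ENNReal.ofReal (Real.exp (t * (hZ i).mk (Z i) ω))) P :=
    hmk.comp (fun _ x => ENNReal.ofReal (Real.exp (t * x))) fun _ => by fun_prop
  have hmeas : ∀ i, Measurable fun ω => ENNReal.ofReal (Real.exp (t * (hZ i).mk (Z i) ω)) :=
    fun i => by
      have := (hZ i).measurable_mk
      fun_prop
  have hae : (fun ω => ∑ i, Z i ω) =ᵐ[P] fun ω => ∑ i, (hZ i).mk (Z i) ω := by
    filter_upwards [ae_all_iff.2 fun i => (hZ i).ae_eq_mk] with ω hω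
    exact Finset.sum_congr rfl fun i _ => hω i
  have hm : Measurable fun ω => ∑ i, (hZ i).mk (Z i) ω :=
    Finset.measurable_sum _ fun i _ => (hZ i).measurable_mk
  rw [Measure.map_congr hae, lintegralExp, lintegral_map (by fun_prop) hm]
  have := lintegral_prod_eq_prod_lintegral_of_indepFun Finset.univ _ hexp hmeas
  have hpt : ∀ ω, ENNReal.ofReal (Real.exp (t * ∑ i, (hZ i).mk (Z i) ω)) =
      ∏ i, ENNReal.ofReal (Real.exp (t * (hZ i).mk (Z i) ω)) := fun ω => by
    rw [Finset.mul_sum, Real.exp_sum, ENNReal.ofReal_prod_of_nonneg fun _ _ => (Real.exp_pos _).le]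
  simp_rw [hpt, this]
  rw [← Fin.prod_const]
  refine Finset.prod_congr rfl fun i _ => ?_
  rw [← hκ i, Measure.map_congr (hZ i).ae_eq_mk, lintegralExp,
    lintegral_map (by fun_prop) (hZ i).measurable_mk]

lemma map_sum_eq_withDensity {Ω Ω' : Type*} [MeasurableSpace Ω] [MeasurableSpace Ω']
    {P : Measure Ω} [IsProbabilityMeasure P] {P' : Measure Ω'}
    {μX μY σX σY ρ : ℝ} (hσX : 0 < σX) (hσY : 0 < σY) (hρ : ρ ∈ Set.Ioo (-1 : ℝ) 1)
    {X Y : Ω' → ℝ} (hXY : HasLaw (fun ω => !₂[X ω, Y ω]) (bivariateNormal μX μY σX σY ρ) P')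
    {n : ℕ} (hn : 1 ≤ n) {Z : Fin n → Ω → ℝ}
    (hident : ∀ i, IdentDistrib (Z i) (fun ω => X ω * Y ω) P P') (hindep : iIndepFun Z P) :
    P.map (fun ω => ∑ i, Z i ω) = volume.withDensity (diffDensity
      (gammaMixture (n * (μX / σX + μY / σY) ^ 2 / (4 * (1 + ρ))) (n / 2) (1 / (σX * σY * (1 + ρ))))
      (gammaMixture (n * (μX / σX - μY / σY) ^ 2 / (4 * (1 - ρ))) (n / 2)
        (1 / (σX * σY * (1 - ρ))))) := by
  have hn' : (0 : ℝ) < n := by exact_mod_cast hn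
  have p1 : 0 < 1 + ρ := by linarith [hρ.1]
  have p2 : 0 < 1 - ρ := by linarith [hρ.2]
  have hs : 0 < σX * σY := mul_pos hσX hσY
  have hZ : ∀ i, AEMeasurable (Z i) P := fun i => (hident i).aemeasurable_fst
  have hsum : AEMeasurable (fun ω => ∑ i, Z i ω) P := Finset.aemeasurable_fun_sum _ fun i _ => hZ i
  have hκ : P'.map (fun ω => X ω * Y ω) =
      (bivariateNormal μX μY σX σY ρ).map (fun v => v 0 * v 1) := by
    rw [← hXY.map_eq, AEMeasurable.map_map_of_aemeasurable (by fun_prop) hXY.aemeasurable]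
    rfl
  have : IsProbabilityMeasure (P.map fun ω => ∑ i, Z i ω) := Measure.isProbabilityMeasure_map hsum
  have key : ∀ t, (1 + ρ) * (σX * σY * t) < 1 → (1 - ρ) * (σX * σY * -t) < 1 →
      lintegralExp (P.map fun ω => ∑ i, Z i ω) t = ENNReal.ofReal
        (((1 / (σX * σY * (1 + ρ))) / (1 / (σX * σY * (1 + ρ)) - t)) ^ ((n : ℝ) / 2) *
          Real.exp (n * (μX / σX + μY / σY) ^ 2 / (4 * (1 + ρ)) *
            ((1 / (σX * σY * (1 + ρ))) / (1 / (σX * σY * (1 + ρ)) - t) - 1))) *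
        ENNReal.ofReal
        (((1 / (σX * σY * (1 - ρ))) / (1 / (σX * σY * (1 - ρ)) - -t)) ^ ((n : ℝ) / 2) *
          Real.exp (n * (μX / σX - μY / σY) ^ 2 / (4 * (1 - ρ)) *
            ((1 / (σX * σY * (1 - ρ))) / (1 / (σX * σY * (1 - ρ)) - -t) - 1))) := by
    intro t h1 h2
    rw [lintegralExp_map_sum hZ (fun i => (hident i).map_eq) hindep, hκ, lintegralExp,
      lintegral_map (by fun_prop) (by fun_prop),
      lintegral_exp_mul_bivariateNormal μX μY hσX hσY hρ h1 h2, mul_pow]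
    -- One computation serves both factors: ρ' = 1 + ρ at t, and ρ' = 1 - ρ at -t.
    have aux : ∀ {ρ' m t : ℝ}, 0 < ρ' → ρ' * (σX * σY * t) < 1 →
        ENNReal.ofReal ((1 - ρ' * (σX * σY * t)) ^ (-(1 / 2) : ℝ) *
          Real.exp (m ^ 2 * (σX * σY * t / 4) / (1 - ρ' * (σX * σY * t)))) ^ n =
        ENNReal.ofReal (((1 / (σX * σY * ρ')) / (1 / (σX * σY * ρ') - t)) ^ ((n : ℝ) / 2) *
          Real.exp (n * m ^ 2 / (4 * ρ') *
            ((1 / (σX * σY * ρ')) / (1 / (σX * σY * ρ') - t) - 1))) := by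
      intro ρ' m t hρ' ht
      have hd : 0 < 1 - ρ' * (σX * σY * t) := by linarith
      have e : (1 / (σX * σY * ρ')) / (1 / (σX * σY * ρ') - t) = (1 - ρ' * (σX * σY * t))⁻¹ := by
        have : 1 / (σX * σY * ρ') - t = (1 - ρ' * (σX * σY * t)) / (σX * σY * ρ') := by
          field_simp
        rw [this]; field_simp
      rw [← ENNReal.ofReal_pow (by positivity), mul_pow, ← Real.rpow_natCast,
        ← Real.rpow_mul hd.le, ← Real.exp_nat_mul, e, Real.inv_rpow hd.le, ← Real.rpow_neg hd.le]
      congr 2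
      · congr 1; ring
      · congr 1
        generalize hD : 1 - ρ' * (σX * σY * t) = D at hd
        have : σX * σY * t = (1 - D) / ρ' := by rw [← hD]; field_simp; ring
        rw [this]
        field_simp
    rw [aux p1 h1, aux p2 h2]
  -- Since 1 ± ρ < 2, both moment generating functions are finite on this interval.
  have hε : 0 < 1 / (2 * (σX * σY)) := by positivity
  have hb : ∀ t, |t| < 1 / (2 * (σX * σY)) →
      (1 + ρ) * (σX * σY * t) < 1 ∧ (1 - ρ) * (σX * σY * -t) < 1 := by
    intro t ht
    rw [lt_div_iff₀ (by positivity)] at ht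
    have h1 : |σX * σY * t| < 1 / 2 := by
      rw [abs_mul, abs_of_pos hs]; linarith
    rw [abs_lt] at h1
    constructor
    · nlinarith [hρ.1, hρ.2]
    · rw [mul_neg]; nlinarith [hρ.1, hρ.2]
  refine ext_of_lintegralExp hε (fun t ht => ?_) fun t ht => ?_
  · obtain ⟨h1, h2⟩ := hb t ht
    rw [key t h1 h2, lintegralExp_withDensity_diffDensity (by fun_prop) (by fun_prop),
      lintegral_exp_mul_gammaMixture (by positivity) (by positivity) (by positivity),
      lintegral_exp_mul_gammaMixture (by positivity) (by positivity) (by positivity)]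
    · rw [lt_div_iff₀ (by positivity)]; linarith
    · rw [lt_div_iff₀ (by positivity)]; linarith
  · obtain ⟨h1, h2⟩ := hb t ht
    rw [key t h1 h2]
    exact ENNReal.mul_lt_top ENNReal.ofReal_lt_top ENNReal.ofReal_lt_top

/-! ### The difference of two independent gamma variables -/

/-- The left side is the integral of u^s e^(-x) over x > u, where u^s ≤ x^s. It bounds a gamma
density of shape at least 1 by its rate. -/
lemma rpow_mul_exp_neg_le_Gamma {s u : ℝ} (hs : 0 ≤ s) (hu : 0 ≤ u) :
    u ^ s * Real.exp (-u) ≤ Real.Gamma (s + 1) := by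
  have hint := Real.GammaIntegral_convergent (s := s + 1) (by linarith)
  rw [add_sub_cancel_right] at hint
  rw [Real.Gamma_eq_integral (by linarith), add_sub_cancel_right]
  have hsub : Set.Ioi u ⊆ Set.Ioi (0 : ℝ) := Set.Ioi_subset_Ioi hu
  calc u ^ s * Real.exp (-u) = ∫ x in Set.Ioi u, u ^ s * Real.exp (-x) := by
        rw [integral_const_mul, integral_exp_neg_Ioi]
    _ ≤ ∫ x in Set.Ioi u, Real.exp (-x) * x ^ s := by
        refine setIntegral_mono_on ((integrableOn_exp_neg_Ioi u).const_mul _) (hint.mono_set hsub)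
          measurableSet_Ioi fun x hx => ?_
        rw [mul_comm]
        have := Real.rpow_le_rpow hu (le_of_lt hx) hs
        gcongr
    _ ≤ ∫ x in Set.Ioi (0 : ℝ), Real.exp (-x) * x ^ s := by
        refine setIntegral_mono_set hint ?_ hsub.eventuallyLE
        filter_upwards [self_mem_ae_restrict measurableSet_Ioi] with x hx
        have : (0 : ℝ) < x := hx
        simp only [Pi.zero_apply]
        positivity

lemma gammaPDF_le {a r : ℝ} (ha : 1 ≤ a) (hr : 0 < r) (x : ℝ) :
    gammaPDF a r x ≤ ENNReal.ofReal r := by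
  refine ENNReal.ofReal_le_ofReal ?_
  unfold gammaPDFReal
  split_ifs with hx
  · have hΓ := Real.Gamma_pos_of_pos (by linarith : 0 < a)
    have h := rpow_mul_exp_neg_le_Gamma (sub_nonneg.2 ha) (mul_nonneg hr.le hx)
    rw [sub_add_cancel, Real.mul_rpow hr.le hx] at h
    have e : r ^ a = r * r ^ (a - 1) := by
      rw [mul_comm, ← Real.rpow_add_one hr.ne']; congr 1; ring
    rw [e, div_mul_eq_mul_div, div_mul_eq_mul_div, div_le_iff₀ hΓ]
    calc r * r ^ (a - 1) * x ^ (a - 1) * Real.exp (-(r * x))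
        = r * (r ^ (a - 1) * x ^ (a - 1) * Real.exp (-(r * x))) := by ring
      _ ≤ r * Real.Gamma a := by gcongr
  · exact hr.le

/-- The density on the positive half line of the difference of two independent gamma variables. -/
noncomputable def diffGammaPos (α r β r' x : ℝ) : ℝ :=
  r ^ α * r' ^ β / (Real.Gamma α * Real.Gamma β) * Real.exp (-(r * x)) *
    shiftedGamma β (α - 1) (r + r') x

/-- The density of the difference of two independent gamma variables. -/
noncomputable def diffGamma (α r β r' x : ℝ) : ℝ :=
  if 0 ≤ x then diffGammaPos α r β r' x else diffGammaPos β r' α r (-x)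

lemma diffDensity_neg (F G : ℝ → ENNReal) (x : ℝ) :
    diffDensity G F (-x) = diffDensity F G x := by
  unfold diffDensity
  rw [← lintegral_add_left_eq_self (fun y => G (-x + y) * F y) x]
  refine lintegral_congr fun y => ?_
  rw [neg_add_cancel_left, mul_comm]

lemma diffGammaPos_nonneg {α r β r' x : ℝ} (hα : 0 < α) (hr : 0 < r) (hβ : 0 < β) (hr' : 0 < r')
    (hx : 0 ≤ x) : 0 ≤ diffGammaPos α r β r' x := by
  have h1 := Real.Gamma_pos_of_pos hα
  have h2 := Real.Gamma_pos_of_pos hβ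
  have := shiftedGamma_nonneg (p := β) (γ := α - 1) (c := r + r') hx
  unfold diffGammaPos
  positivity

lemma diffDensity_gammaPDF_of_nonneg {α r β r' x : ℝ} (hα : 0 < α) (hr : 0 < r) (hβ : 0 < β)
    (hr' : 0 < r') (hx : 0 < x ∨ (0 ≤ α - 1 ∧ 0 ≤ x)) :
    diffDensity (gammaPDF α r) (gammaPDF β r') x = ENNReal.ofReal (diffGammaPos α r β r' x) := by
  have h1 := Real.Gamma_pos_of_pos hα
  have h2 := Real.Gamma_pos_of_pos hβ
  have hx0 : 0 ≤ x := hx.elim le_of_lt And.right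
  have hc : 0 < r + r' := by linarith
  have hae : (fun y => gammaPDF α r (x + y) * gammaPDF β r' y) =ᵐ[volume]
      (Set.Ioi (0 : ℝ)).indicator (fun y => ENNReal.ofReal
        (r ^ α * r' ^ β / (Real.Gamma α * Real.Gamma β) * Real.exp (-(r * x)) *
          (y ^ (β - 1) * (x + y) ^ (α - 1) * Real.exp (-((r + r') * y))))) := by
    have h0 : ∀ᵐ y : ℝ, y ≠ 0 := Measure.ae_ne volume 0
    filter_upwards [h0] with y hy
    rcases lt_or_gt_of_ne hy with hy | hy
    · rw [gammaPDF_of_neg hy, mul_zero, Set.indicator_of_notMem (by simpa using hy.le)]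
    · rw [Set.indicator_of_mem (by simpa using hy), gammaPDF_of_nonneg (by linarith),
        gammaPDF_of_nonneg hy.le, ← ENNReal.ofReal_mul (by positivity)]
      congr 1
      have : Real.exp (-(r * (x + y))) * Real.exp (-(r' * y)) =
          Real.exp (-(r * x)) * Real.exp (-((r + r') * y)) := by
        rw [← Real.exp_add, ← Real.exp_add]; congr 1; ring
      linear_combination (r ^ α / Real.Gamma α * (x + y) ^ (α - 1) *
        (r' ^ β / Real.Gamma β * y ^ (β - 1))) * this
  rw [diffDensity, lintegral_congr_ae hae, lintegral_indicator measurableSet_Ioi,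
    ← ofReal_integral_eq_lintegral_ofReal ((integrableOn_shiftedGamma hβ hc hx).const_mul _),
    integral_const_mul]
  · rfl
  · filter_upwards [self_mem_ae_restrict measurableSet_Ioi] with y hy
    have : (0 : ℝ) < y := hy
    simp only [Pi.zero_apply]
    positivity

lemma diffDensity_gammaPDF {α r β r' x : ℝ} (hα : 0 < α) (hr : 0 < r) (hβ : 0 < β)
    (hr' : 0 < r') (hx : x ≠ 0 ∨ (1 ≤ α ∧ 1 ≤ β)) :
    diffDensity (gammaPDF α r) (gammaPDF β r') x = ENNReal.ofReal (diffGamma α r β r' x) := by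
  unfold diffGamma
  split_ifs with h
  · refine diffDensity_gammaPDF_of_nonneg hα hr hβ hr' ?_
    rcases hx with hx | hx
    · exact Or.inl (lt_of_le_of_ne h hx.symm)
    · exact Or.inr ⟨by linarith [hx.1], h⟩
  · rw [← diffDensity_neg]
    exact diffDensity_gammaPDF_of_nonneg hβ hr' hα hr (Or.inl (by linarith))

lemma diffGamma_nonneg {α r β r' : ℝ} (hα : 0 < α) (hr : 0 < r) (hβ : 0 < β) (hr' : 0 < r')
    (x : ℝ) : 0 ≤ diffGamma α r β r' x := by
  unfold diffGamma
  split_ifs with h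
  · exact diffGammaPos_nonneg hα hr hβ hr' h
  · exact diffGammaPos_nonneg hβ hr' hα hr (by linarith)

/-- In the convolution, the density with shape at least 1 is bounded by its rate and the other
integrates to 1. The bound depends neither on x nor on the shapes. -/
lemma diffGamma_le {α r β r' x : ℝ} (hα : 0 < α) (hr : 0 < r) (hβ : 0 < β) (hr' : 0 < r')
    (hx : x ≠ 0 ∨ (1 ≤ α ∧ 1 ≤ β)) (h : 1 ≤ α ∨ 1 ≤ β) : diffGamma α r β r' x ≤ r + r' := by
  rw [← ENNReal.ofReal_le_ofReal_iff (by linarith), ← diffDensity_gammaPDF hα hr hβ hr' hx,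
    diffDensity]
  rcases h with h | h
  · calc ∫⁻ y, gammaPDF α r (x + y) * gammaPDF β r' y
        ≤ ∫⁻ y, ENNReal.ofReal r * gammaPDF β r' y := by
          gcongr; exact gammaPDF_le h hr _
      _ = ENNReal.ofReal r := by
          rw [lintegral_const_mul _ (by fun_prop), lintegral_gammaPDF_eq_one hβ hr', mul_one]
      _ ≤ ENNReal.ofReal (r + r') := ENNReal.ofReal_le_ofReal (by linarith)
  · calc ∫⁻ y, gammaPDF α r (x + y) * gammaPDF β r' y
        ≤ ∫⁻ y, gammaPDF α r (x + y) * ENNReal.ofReal r' := by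
          gcongr; exact gammaPDF_le h hr' _
      _ = ENNReal.ofReal r' := by
          rw [lintegral_mul_const _ (by fun_prop), lintegral_add_left_eq_self,
            lintegral_gammaPDF_eq_one hα hr, one_mul]
      _ ≤ ENNReal.ofReal (r + r') := ENNReal.ofReal_le_ofReal (by linarith)

/-- The two branches of `diffGamma` therefore match at 0. -/
lemma diffGammaPos_zero_swap (α r β r' : ℝ) :
    diffGammaPos α r β r' 0 = diffGammaPos β r' α r 0 := by
  have : shiftedGamma β (α - 1) (r + r') 0 = shiftedGamma α (β - 1) (r' + r) 0 := by
    unfold shiftedGamma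
    simp only [zero_add, add_comm r' r, mul_comm (_ ^ (β - 1))]
  simp only [diffGammaPos, this, mul_zero, neg_zero, Real.exp_zero, mul_one]
  rw [mul_comm (r ^ α), mul_comm (Real.Gamma α)]

lemma continuousOn_diffGammaPos_Ioi {α r β r' : ℝ} (hr : 0 < r) (hβ : 0 < β) (hr' : 0 < r') :
    ContinuousOn (diffGammaPos α r β r') (Set.Ioi 0) :=
  ContinuousOn.mul (by fun_prop) (continuousOn_shiftedGamma_Ioi hβ (by linarith))

lemma continuousOn_diffGammaPos_Ici {α r β r' : ℝ} (hα : 1 ≤ α) (hr : 0 < r) (hβ : 0 < β)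
    (hr' : 0 < r') : ContinuousOn (diffGammaPos α r β r') (Set.Ici 0) :=
  ContinuousOn.mul (by fun_prop)
    (continuousOn_shiftedGamma_Ici hβ (by linarith) (Or.inr ⟨by linarith, le_rfl⟩))

lemma continuousAt_diffGamma {α r β r' x : ℝ} (hα : 0 < α) (hr : 0 < r) (hβ : 0 < β) (hr' : 0 < r')
    (hx : x ≠ 0 ∨ (1 ≤ α ∧ 1 ≤ β)) : ContinuousAt (diffGamma α r β r') x := by
  rcases lt_trichotomy x 0 with h | rfl | h
  · have h1 : ContinuousAt (fun x => diffGammaPos β r' α r (-x)) x :=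
      ContinuousAt.comp (f := fun x : ℝ => -x) (g := diffGammaPos β r' α r)
        ((continuousOn_diffGammaPos_Ioi hr' hα hr).continuousAt (Ioi_mem_nhds (by linarith)))
        continuousAt_neg
    refine h1.congr ?_
    filter_upwards [Iio_mem_nhds h] with y hy
    rw [diffGamma, if_neg (not_le.2 hy)]
  · obtain ⟨hα1, hβ1⟩ := hx.resolve_left (by simp)
    rw [continuousAt_iff_continuous_left_right]
    constructor
    · have h1 : ContinuousOn (fun x => diffGammaPos β r' α r (-x)) (Set.Iic 0) :=
        (continuousOn_diffGammaPos_Ici hβ1 hr' hα hr).comp continuousOn_neg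
          (fun y hy => by simpa using hy)
      refine (h1 0 (by simp)).congr (fun y hy => ?_) ?_
      · rcases eq_or_lt_of_le (show y ≤ 0 from hy) with rfl | hy
        · rw [diffGamma, if_pos le_rfl, neg_zero, diffGammaPos_zero_swap]
        · rw [diffGamma, if_neg (not_le.2 hy)]
      · rw [diffGamma, if_pos le_rfl, neg_zero, diffGammaPos_zero_swap]
    · refine (continuousOn_diffGammaPos_Ici hα1 hr hβ hr' 0 (by simp)).congr (fun y hy => ?_) ?_
      · rw [diffGamma, if_pos (show (0 : ℝ) ≤ y from hy)]
      · rw [diffGamma, if_pos le_rfl]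
  · refine ((continuousOn_diffGammaPos_Ioi (α := α) hr hβ hr').continuousAt
      (Ioi_mem_nhds h)).congr ?_
    filter_upwards [Ioi_mem_nhds h] with y hy
    rw [diffGamma, if_pos (le_of_lt hy)]

lemma diffGammaPos_eq_tricomiU {α r β r' x : ℝ} {m : ℕ} (hr : 0 < r) (hβ : 0 < β)
    (hr' : 0 < r') (hm : α + β = m) (h : (0 < x ∧ 1 ≤ m) ∨ (x = 0 ∧ 2 ≤ m)) :
    diffGammaPos α r β r' x = r ^ α * r' ^ β * (r + r') ^ (1 - (m : ℝ)) / Real.Gamma α *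
      Real.exp (-(r * x)) * tricomiU (1 - α) (2 - m) ((r + r') * x) := by
  have hc : 0 < r + r' := by linarith
  have hx : 0 ≤ x := h.elim (fun h => h.1.le) fun h => h.1.ge
  have hU := tricomiU_eq (z := (r + r') * x) hβ hm
    (h.imp (fun h => ⟨mul_pos hc h.1, h.2⟩) fun h => ⟨by simp [h.1], h.2⟩)
  rw [show 2 - α - β = 2 - (m : ℝ) by linarith] at hU
  have hΓ := (Real.Gamma_pos_of_pos hβ).ne'
  rw [hU, diffGammaPos, shiftedGamma_eq_rpow_mul hc hx,
    show -(β + (α - 1)) = 1 - (m : ℝ) by linarith]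
  field_simp

/-! ### The difference of two Poisson mixtures of gamma variables -/

/-- The contribution of the `i`-th and the `j`-th component of two gamma mixtures to the density of
their difference. -/
noncomputable def mixTerm (l r l' r' a x : ℝ) (i j : ℕ) : ℝ :=
  poissonWeight l i * poissonWeight l' j * diffGamma (a + i) r (a + j) r' x

/-- The contribution of all components with total index `k`. -/
noncomputable def mixSum (l r l' r' a x : ℝ) (k : ℕ) : ℝ :=
  ∑ j ∈ Finset.range (k + 1), mixTerm l r l' r' a x (k - j) j

section Mixture

variable {l r l' r' a x : ℝ}

lemma mixTerm_nonneg (hl : 0 ≤ l) (hr : 0 < r) (hl' : 0 ≤ l') (hr' : 0 < r') (ha : 0 < a) (x : ℝ)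
    (i j : ℕ) : 0 ≤ mixTerm l r l' r' a x i j := by
  have h1 := poissonWeight_nonneg hl i
  have h2 := poissonWeight_nonneg hl' j
  have h3 := diffGamma_nonneg (α := a + i) (β := a + j) (by positivity) hr (by positivity) hr' x
  unfold mixTerm
  positivity

lemma mixSum_nonneg (hl : 0 ≤ l) (hr : 0 < r) (hl' : 0 ≤ l') (hr' : 0 < r') (ha : 0 < a) (x : ℝ)
    (k : ℕ) : 0 ≤ mixSum l r l' r' a x k :=
  Finset.sum_nonneg fun _ _ => mixTerm_nonneg hl hr hl' hr' ha x _ _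

lemma shape_condition (hx : x ≠ 0 ∨ 1 ≤ a) (i j : ℕ) : x ≠ 0 ∨ (1 ≤ a + i ∧ 1 ≤ a + j) :=
  hx.imp_right fun h => ⟨h.trans (le_add_of_nonneg_right i.cast_nonneg),
    h.trans (le_add_of_nonneg_right j.cast_nonneg)⟩

lemma continuousAt_mixSum (hr : 0 < r) (hr' : 0 < r') (ha : 0 < a) (hx : x ≠ 0 ∨ 1 ≤ a) (k : ℕ) :
    ContinuousAt (fun x => mixSum l r l' r' a x k) x := by
  unfold mixSum mixTerm
  refine tendsto_finsetSum _ fun j _ => ?_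
  exact (continuousAt_diffGamma (by positivity) hr (by positivity) hr'
    (shape_condition hx _ _)).tendsto.const_mul _

/-- When the total index is at least 1, one of the shapes a + i, a + j is at least 1, so
`diffGamma_le` applies to every summand. The term of index 0 escapes this bound when a < 1, hence
the shift by one. -/
lemma mixSum_succ_le (hl : 0 ≤ l) (hr : 0 < r) (hl' : 0 ≤ l') (hr' : 0 < r') (ha : 0 < a)
    (hx : x ≠ 0 ∨ 1 ≤ a) (k : ℕ) :
    mixSum l r l' r' a x (k + 1) ≤ (r + r') *
      ∑ j ∈ Finset.range (k + 1 + 1), poissonWeight l' j * poissonWeight l (k + 1 - j) := by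
  rw [Finset.mul_sum]
  refine Finset.sum_le_sum fun j hj => ?_
  have h1 := poissonWeight_nonneg hl (k + 1 - j)
  have h2 := poissonWeight_nonneg hl' j
  have h3 : 1 ≤ a + (k + 1 - j : ℕ) ∨ 1 ≤ a + j := by
    rcases Nat.eq_zero_or_pos j with rfl | hj
    · left; push_cast [Nat.sub_zero]; linarith [(k.cast_nonneg : (0 : ℝ) ≤ k)]
    · right
      have : (1 : ℝ) ≤ j := by exact_mod_cast hj
      linarith
  have h4 := diffGamma_le (by positivity) hr (by positivity) hr'
    (shape_condition hx (k + 1 - j) j) h3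
  calc mixTerm l r l' r' a x (k + 1 - j) j
      ≤ poissonWeight l (k + 1 - j) * poissonWeight l' j * (r + r') := by
        unfold mixTerm; gcongr
    _ = _ := by ring

lemma summable_poissonWeight_convolution (hl : 0 ≤ l) (hl' : 0 ≤ l') :
    Summable fun k => ∑ j ∈ Finset.range (k + 1), poissonWeight l' j * poissonWeight l (k - j) := by
  have h : ∀ {l : ℝ}, 0 ≤ l → Summable fun i => ‖poissonWeight l i‖ := fun {l} _ => by
    simpa using (hasSum_poissonWeight_mul_pow l 1).summable.norm
  exact (summable_norm_sum_mul_range_of_summable_norm (h hl') (h hl)).of_norm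

lemma summable_mixSum_bound (r r' : ℝ) (hl : 0 ≤ l) (hl' : 0 ≤ l') :
    Summable fun k => (r + r') *
      ∑ j ∈ Finset.range (k + 1 + 1), poissonWeight l' j * poissonWeight l (k + 1 - j) :=
  ((summable_nat_add_iff 1).2 (summable_poissonWeight_convolution hl hl')).mul_left _

lemma summable_mixSum (hl : 0 ≤ l) (hr : 0 < r) (hl' : 0 ≤ l') (hr' : 0 < r') (ha : 0 < a)
    (hx : x ≠ 0 ∨ 1 ≤ a) : Summable (mixSum l r l' r' a x) := by
  rw [← summable_nat_add_iff 1]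
  exact Summable.of_nonneg_of_le (fun k => mixSum_nonneg hl hr hl' hr' ha x _)
    (fun k => mixSum_succ_le hl hr hl' hr' ha hx k) (summable_mixSum_bound r r' hl hl')

lemma continuousOn_tsum_mixSum (hl : 0 ≤ l) (hr : 0 < r) (hl' : 0 ≤ l') (hr' : 0 < r')
    (ha : 0 < a) :
    ContinuousOn (fun x => ∑' k, mixSum l r l' r' a x k) {x | x ≠ 0 ∨ 1 ≤ a} := by
  -- The Weierstrass test handles all terms but the first, which is continuous by itself.
  have h : ContinuousOn (fun x => mixSum l r l' r' a x 0 + ∑' k, mixSum l r l' r' a x (k + 1))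
      {x | x ≠ 0 ∨ 1 ≤ a} := by
    refine ContinuousOn.add
      (fun x hx => (continuousAt_mixSum hr hr' ha hx 0).continuousWithinAt) ?_
    refine continuousOn_tsum
      (fun k x hx => (continuousAt_mixSum hr hr' ha hx (k + 1)).continuousWithinAt)
      (summable_mixSum_bound r r' hl hl') fun k x hx => ?_
    rw [Real.norm_of_nonneg (mixSum_nonneg hl hr hl' hr' ha x _)]
    exact mixSum_succ_le hl hr hl' hr' ha hx k
  exact h.congr fun x hx => (summable_mixSum hl hr hl' hr' ha hx).tsum_eq_zero_add

lemma diffDensity_gammaMixture (hl : 0 ≤ l) (hr : 0 < r) (hl' : 0 ≤ l') (hr' : 0 < r')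
    (ha : 0 < a) (hx : x ≠ 0 ∨ 1 ≤ a) :
    diffDensity (gammaMixture l a r) (gammaMixture l' a r') x =
      ENNReal.ofReal (∑' k, mixSum l r l' r' a x k) := by
  have h1 : diffDensity (gammaMixture l a r) (gammaMixture l' a r') x =
      ∑' i, ∑' j, ENNReal.ofReal (mixTerm l r l' r' a x i j) := by
    simp only [diffDensity, gammaMixture, ← ENNReal.tsum_mul_left, ← ENNReal.tsum_mul_right]
    rw [lintegral_tsum fun i => by
      exact (Measurable.tsum fun j => by fun_prop).aemeasurable, ENNReal.tsum_comm]
    refine tsum_congr fun i => ?_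
    rw [lintegral_tsum fun j => by fun_prop]
    refine tsum_congr fun j => ?_
    rw [mixTerm, ENNReal.ofReal_mul
      (mul_nonneg (poissonWeight_nonneg hl _) (poissonWeight_nonneg hl' _)),
      ENNReal.ofReal_mul (poissonWeight_nonneg hl _),
      ← diffDensity_gammaPDF (by positivity) hr (by positivity) hr' (shape_condition hx _ _),
      diffDensity, ← lintegral_const_mul _ (by fun_prop)]
    refine lintegral_congr fun y => ?_
    ring
  -- In [0, ∞] the double sum may be regrouped along antidiagonals freely.
  rw [h1, ← ENNReal.tsum_prod, ← Finset.HasAntidiagonal.sigmaAntidiagonalEquivProd.tsum_eq, ENNReal.tsum_sigma',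
    ENNReal.ofReal_tsum_of_nonneg (mixSum_nonneg hl hr hl' hr' ha x)
      (summable_mixSum hl hr hl' hr' ha hx)]
  refine tsum_congr fun k => ?_
  rw [tsum_fintype, mixSum,
    ENNReal.ofReal_sum_of_nonneg fun _ _ => mixTerm_nonneg hl hr hl' hr' ha x _ _,
    ← Finset.Nat.sum_antidiagonal_eq_sum_range_succ
      (fun j i => ENNReal.ofReal (mixTerm l r l' r' a x i j)),
    ← Finset.Nat.sum_antidiagonal_swap]
  exact Finset.sum_coe_sort (Finset.HasAntidiagonal.antidiagonal k)
    (fun p => ENNReal.ofReal (mixTerm l r l' r' a x p.1 p.2))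

end Mixture

/-! ### The double series -/

/-- Both sides are positive, and after taking logarithms the claim is a polynomial identity. It is
used with s = σXσY, p = 1 + ρ and q = 1 - ρ, so that p + q = 2. -/
lemma gamma_weight_identity {s p q : ℝ} (hs : 0 < s) (hp : 0 < p) (hq : 0 < q) (ν : ℝ) (i j : ℕ) :
    (1 / (s * p)) ^ (ν / 2 + i) * (1 / (s * q)) ^ (ν / 2 + j) *
        (1 / (s * p) + 1 / (s * q)) ^ (1 - (ν + i + j)) * (p + q) ^ (ν + i + j - 1) =
      (p * q) ^ (ν / 2 - 1) / s * (q ^ i * p ^ j) := by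
  have hpq : 0 < p + q := by linarith
  have e0 : 1 / (s * p) + 1 / (s * q) = (p + q) / (s * p * q) := by field_simp; ring
  have l1 : Real.log (1 / (s * p)) = -(Real.log s + Real.log p) := by
    rw [one_div, Real.log_inv, Real.log_mul hs.ne' hp.ne']
  have l2 : Real.log (1 / (s * q)) = -(Real.log s + Real.log q) := by
    rw [one_div, Real.log_inv, Real.log_mul hs.ne' hq.ne']
  have l3 : Real.log ((p + q) / (s * p * q)) =
      Real.log (p + q) - (Real.log s + Real.log p + Real.log q) := by
    rw [Real.log_div (by positivity) (by positivity), Real.log_mul (by positivity) hq.ne',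
      Real.log_mul hs.ne' hp.ne']
  have l4 : Real.log (p * q) = Real.log p + Real.log q := Real.log_mul hp.ne' hq.ne'
  rw [e0]
  refine Real.log_injOn_pos (Set.mem_Ioi.2 (by positivity)) (Set.mem_Ioi.2 (by positivity)) ?_
  rw [Real.log_mul (by positivity) (by positivity), Real.log_mul (by positivity) (by positivity),
    Real.log_mul (by positivity) (by positivity), Real.log_mul (by positivity) (by positivity),
    Real.log_div (by positivity) (by positivity), Real.log_mul (by positivity) (by positivity),
    Real.log_rpow (by positivity), Real.log_rpow (by positivity), Real.log_rpow (by positivity),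
    Real.log_rpow (by positivity), Real.log_rpow (by positivity), Real.log_pow, Real.log_pow,
    l1, l2, l3, l4]
  ring

/-- The factors of the double series that do not depend on `x`. -/
lemma poissonWeight_mul_eq {σX σY ρ : ℝ} (hσX : 0 < σX) (hσY : 0 < σY)
    (hρ : ρ ∈ Set.Ioo (-1 : ℝ) 1) (μX μY : ℝ) (n i j : ℕ) :
    poissonWeight (n * (μX / σX + μY / σY) ^ 2 / (4 * (1 + ρ))) i *
      poissonWeight (n * (μX / σX - μY / σY) ^ 2 / (4 * (1 - ρ))) j *
      ((1 / (σX * σY * (1 + ρ))) ^ ((n : ℝ) / 2 + i) * (1 / (σX * σY * (1 - ρ))) ^ ((n : ℝ) / 2 + j)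
        * (1 / (σX * σY * (1 + ρ)) + 1 / (σX * σY * (1 - ρ))) ^ (1 - ((n : ℝ) + i + j))) =
    (1 - ρ ^ 2) ^ ((n : ℝ) / 2 - 1) / ((2 : ℝ) ^ ((n : ℝ) - 1) * σX * σY) *
      Real.exp (-((n : ℝ) / (2 * (1 - ρ ^ 2)))
        * (μX ^ 2 / σX ^ 2 + μY ^ 2 / σY ^ 2 - 2 * ρ * μX * μY / (σX * σY))) *
      (((n : ℝ) / 8) ^ (i + j) / ((i + j).factorial : ℝ) * ((i + j).choose j : ℝ)
        * ((1 + ρ) / (1 - ρ)) ^ j * (μX / σX - μY / σY) ^ (2 * j)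
        * ((1 - ρ) / (1 + ρ)) ^ i * (μX / σX + μY / σY) ^ (2 * i)) := by
  have p1 : 0 < 1 + ρ := by linarith [hρ.1]
  have p2 : 0 < 1 - ρ := by linarith [hρ.2]
  have hs : 0 < σX * σY := mul_pos hσX hσY
  have key := gamma_weight_identity hs p1 p2 (n : ℝ) i j
  rw [show 1 + ρ + (1 - ρ) = 2 by ring, show (1 + ρ) * (1 - ρ) = 1 - ρ ^ 2 by ring,
    show (n : ℝ) + i + j - 1 = (n : ℝ) - 1 + (i + j : ℕ) by push_cast; ring,
    Real.rpow_add two_pos, Real.rpow_natCast, ← mul_assoc, ← mul_assoc] at key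
  have h2 : (0 : ℝ) < (2 : ℝ) ^ ((n : ℝ) - 1) := by positivity
  set W := (1 / (σX * σY * (1 + ρ))) ^ ((n : ℝ) / 2 + i) *
    (1 / (σX * σY * (1 - ρ))) ^ ((n : ℝ) / 2 + j) *
    (1 / (σX * σY * (1 + ρ)) + 1 / (σX * σY * (1 - ρ))) ^ (1 - ((n : ℝ) + i + j))
  have hW : W = (1 - ρ ^ 2) ^ ((n : ℝ) / 2 - 1) / (σX * σY) * (1 - ρ) ^ i * (1 + ρ) ^ j /
      ((2 : ℝ) ^ ((n : ℝ) - 1) * 2 ^ (i + j)) := by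
    rw [eq_div_iff (by positivity), ← mul_assoc, key]
  have hexp : Real.exp (-((n : ℝ) / (2 * (1 - ρ ^ 2)))
        * (μX ^ 2 / σX ^ 2 + μY ^ 2 / σY ^ 2 - 2 * ρ * μX * μY / (σX * σY))) =
      Real.exp (-(n * (μX / σX + μY / σY) ^ 2 / (4 * (1 + ρ)))) *
        Real.exp (-(n * (μX / σX - μY / σY) ^ 2 / (4 * (1 - ρ)))) := by
    rw [← Real.exp_add]
    congr 1
    rw [show 1 - ρ ^ 2 = (1 + ρ) * (1 - ρ) by ring]
    field_simp
    ring
  have hfac : ((i + j).choose j : ℝ) = (i + j).factorial / (i.factorial * j.factorial) := by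
    rw [eq_div_iff (by positivity), ← mul_assoc]
    exact_mod_cast Nat.add_choose_mul_factorial_mul_factorial i j
  -- In 8 = 4 · 2, the 4 comes from the Poisson parameters and the 2 from (1+ρ) + (1-ρ).
  have hpow : ((n : ℝ) / 8) ^ (i + j) = (n : ℝ) ^ i * n ^ j / (4 ^ i * 4 ^ j * 2 ^ (i + j)) := by
    rw [← pow_add, ← pow_add, ← mul_pow, div_pow]
    norm_num
  rw [hW, hexp, hfac, hpow]
  generalize (μX / σX + μY / σY) = m₁
  generalize (μX / σX - μY / σY) = m₂
  simp only [poissonWeight, div_pow, mul_pow, pow_mul]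
  field_simp

/-- For x < 0 the two gamma variables exchange roles. This is why the shape offset `aIdx` and the
rate 1/(σXσY(1 + ρ sgn x)) depend on the sign of x. -/
lemma seriesPrefactor_mul_seriesTerm {σX σY ρ : ℝ} (hσX : 0 < σX) (hσY : 0 < σY)
    (hρ : ρ ∈ Set.Ioo (-1 : ℝ) 1) (μX μY : ℝ) {n : ℕ} (hn : 1 ≤ n) {x : ℝ}
    (hx : x ≠ 0 ∨ 2 ≤ n) (i j : ℕ) :
    seriesPrefactor n μX μY σX σY ρ x * seriesTerm n μX μY σX σY ρ x (i + j) j =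
      mixTerm (n * (μX / σX + μY / σY) ^ 2 / (4 * (1 + ρ))) (1 / (σX * σY * (1 + ρ)))
        (n * (μX / σX - μY / σY) ^ 2 / (4 * (1 - ρ))) (1 / (σX * σY * (1 - ρ))) (n / 2) x i j := by
  have p1 : 0 < 1 + ρ := by linarith [hρ.1]
  have p2 : 0 < 1 - ρ := by linarith [hρ.2]
  have hs : 0 < σX * σY := mul_pos hσX hσY
  have hn0 : (0 : ℝ) < n := by exact_mod_cast hn
  have hw := poissonWeight_mul_eq hσX hσY hρ μX μY n i j
  have hc : 1 / (σX * σY * (1 + ρ)) + 1 / (σX * σY * (1 - ρ)) =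
      2 / (σX * σY * (1 - ρ ^ 2)) := by
    rw [show 1 - ρ ^ 2 = (1 + ρ) * (1 - ρ) by ring]
    field_simp
    ring
  have hm : (n : ℝ) / 2 + i + (n / 2 + j) = (n + i + j : ℕ) := by push_cast; ring
  have hmR : ((n + i + j : ℕ) : ℝ) = n + i + j := by push_cast; ring
  have hz : 2 * |x| / (σX * σY * (1 - ρ ^ 2)) = 2 / (σX * σY * (1 - ρ ^ 2)) * |x| := by ring
  rcases le_or_gt 0 x with h0 | h0
  · have h : (0 < x ∧ 1 ≤ n + i + j) ∨ (x = 0 ∧ 2 ≤ n + i + j) := by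
      rcases h0.lt_or_eq with h | h
      · exact Or.inl ⟨h, by lia⟩
      · exact Or.inr ⟨h.symm, by have := hx.resolve_left (by simp [← h]); lia⟩
    have hexp : -(|x| / (σX * σY * (1 + ρ * Real.sign x))) = -(1 / (σX * σY * (1 + ρ)) * x) := by
      rcases h0.lt_or_eq with h | rfl
      · rw [Real.sign_of_pos h, abs_of_pos h, mul_one]; ring
      -- At x = 0 the value `Real.sign 0 = 0` is harmless, since both exponents vanish.
      · simp
    have ha : aIdx j (i + j) x = i := by rw [aIdx, if_pos h0]; push_cast; ring
    rw [mixTerm, diffGamma, if_pos h0, diffGammaPos_eq_tricomiU (m := n + i + j) (by positivity)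
      (by positivity) (by positivity) hm h]
    rw [seriesPrefactor, seriesTerm, ha, sub_eq_add_neg _ (|x| / _), Real.exp_add, hexp,
      Nat.add_sub_cancel, show 2 * (i + j) - 2 * j = 2 * i by lia, hz, abs_of_nonneg h0,
      show 1 - (n : ℝ) / 2 - i = 1 - (n / 2 + i) by ring,
      show 2 - (n : ℝ) - (i + j : ℕ) = 2 - (n + i + j : ℕ) by push_cast; ring, ← hc, hmR]
    generalize tricomiU _ _ _ = U
    linear_combination (-(Real.exp (-(1 / (σX * σY * (1 + ρ)) * x)) /
      Real.Gamma ((n : ℝ) / 2 + i) * U)) * hw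
  · have hexp : -(|x| / (σX * σY * (1 + ρ * Real.sign x))) =
        -(1 / (σX * σY * (1 - ρ)) * -x) := by
      rw [Real.sign_of_neg h0, abs_of_neg h0]; ring
    have ha : aIdx j (i + j) x = j := by rw [aIdx, if_neg (not_le.2 h0)]
    rw [mixTerm, diffGamma, if_neg (not_le.2 h0), diffGammaPos_eq_tricomiU (m := n + i + j)
      (by positivity) (by positivity) (by positivity) (by rw [← hm]; ring)
      (Or.inl ⟨by linarith, by lia⟩)]
    rw [seriesPrefactor, seriesTerm, ha, sub_eq_add_neg _ (|x| / _), Real.exp_add, hexp,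
      Nat.add_sub_cancel, show 2 * (i + j) - 2 * j = 2 * i by lia, hz, abs_of_neg h0,
      show 1 - (n : ℝ) / 2 - j = 1 - (n / 2 + j) by ring,
      show 2 - (n : ℝ) - (i + j : ℕ) = 2 - (n + i + j : ℕ) by push_cast; ring, ← hc, hmR,
      add_comm (1 / (σX * σY * (1 - ρ)))]
    generalize tricomiU _ _ _ = U
    linear_combination (-(Real.exp (-(1 / (σX * σY * (1 - ρ)) * -x)) /
      Real.Gamma ((n : ℝ) / 2 + j) * U)) * hw

lemma seriesPrefactor_pos {σX σY ρ : ℝ} (hσX : 0 < σX) (hσY : 0 < σY)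
    (hρ : ρ ∈ Set.Ioo (-1 : ℝ) 1) (μX μY : ℝ) (n : ℕ) (x : ℝ) :
    0 < seriesPrefactor n μX μY σX σY ρ x := by
  have : 0 < 1 - ρ ^ 2 := by nlinarith [hρ.1, hρ.2]
  unfold seriesPrefactor
  positivity

lemma seriesPrefactor_mul_sum_seriesTerm {σX σY ρ : ℝ} (hσX : 0 < σX) (hσY : 0 < σY)
    (hρ : ρ ∈ Set.Ioo (-1 : ℝ) 1) (μX μY : ℝ) {n : ℕ} (hn : 1 ≤ n) {x : ℝ}
    (hx : x ≠ 0 ∨ 2 ≤ n) (k : ℕ) :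
    seriesPrefactor n μX μY σX σY ρ x *
        ∑ j ∈ Finset.range (k + 1), seriesTerm n μX μY σX σY ρ x k j =
      mixSum (n * (μX / σX + μY / σY) ^ 2 / (4 * (1 + ρ))) (1 / (σX * σY * (1 + ρ)))
        (n * (μX / σX - μY / σY) ^ 2 / (4 * (1 - ρ))) (1 / (σX * σY * (1 - ρ))) (n / 2) x k := by
  rw [Finset.mul_sum, mixSum]
  refine Finset.sum_congr rfl fun j hj => ?_
  rw [← seriesPrefactor_mul_seriesTerm hσX hσY hρ μX μY hn hx,
    Nat.sub_add_cancel (Finset.mem_range_succ_iff.1 hj)]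

/-! ### The density of the sum. -/

theorem theorem2p1
    {Ω Ω' : Type*} [MeasurableSpace Ω] [MeasurableSpace Ω']
    (P : Measure Ω) [IsProbabilityMeasure P] (P' : Measure Ω') [IsProbabilityMeasure P']
    (μX μY σX σY ρ : ℝ) (hσX : 0 < σX) (hσY : 0 < σY) (hρ : ρ ∈ Set.Ioo (-1 : ℝ) 1)
    (X Y : Ω' → ℝ)
    (hXY : HasLaw (fun ω => !₂[X ω, Y ω]) (bivariateNormal μX μY σX σY ρ) P')
    (n : ℕ) (hn : 1 ≤ n) (Z : Fin n → Ω → ℝ)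
    (hident : ∀ i, IdentDistrib (Z i) (fun ω => X ω * Y ω) P P')
    (hindep : iIndepFun Z P) :
    -- the double series converges, and it defines a nonnegative function which is continuous
    (∀ x : ℝ, (x ≠ 0 ∨ 2 ≤ n) →
      Summable (fun k : ℕ => ∑ j ∈ Finset.range (k + 1), seriesTerm n μX μY σX σY ρ x k j) ∧
      0 ≤ seriesDensity n μX μY σX σY ρ x) ∧
    ContinuousOn (seriesDensity n μX μY σX σY ρ) {x | x ≠ 0 ∨ 2 ≤ n} ∧
    -- and which is the probability density function of the sum
    HasLaw (fun ω => ∑ i, Z i ω)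
      (volume.withDensity (fun x => ENNReal.ofReal (seriesDensity n μX μY σX σY ρ x))) P := by
  have p1 : 0 < 1 + ρ := by linarith [hρ.1]
  have p2 : 0 < 1 - ρ := by linarith [hρ.2]
  have hn0 : (0 : ℝ) < n := by exact_mod_cast hn
  have ha : (0 : ℝ) < (n : ℝ) / 2 := by positivity
  have hl : 0 ≤ n * (μX / σX + μY / σY) ^ 2 / (4 * (1 + ρ)) := by positivity
  have hl' : 0 ≤ n * (μX / σX - μY / σY) ^ 2 / (4 * (1 - ρ)) := by positivity
  have hr : 0 < 1 / (σX * σY * (1 + ρ)) := by positivity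
  have hr' : 0 < 1 / (σX * σY * (1 - ρ)) := by positivity
  have hcond : ∀ {x : ℝ}, (x ≠ 0 ∨ 2 ≤ n) ↔ (x ≠ 0 ∨ (1 : ℝ) ≤ n / 2) := fun {x} => by
    rw [le_div_iff₀ two_pos, one_mul]
    norm_cast
  have hterm := fun {x : ℝ} (hx : x ≠ 0 ∨ 2 ≤ n) =>
    seriesPrefactor_mul_sum_seriesTerm hσX hσY hρ μX μY hn hx
  have hsum : ∀ {x : ℝ}, (x ≠ 0 ∨ 2 ≤ n) → seriesDensity n μX μY σX σY ρ x =
      ∑' k, mixSum (n * (μX / σX + μY / σY) ^ 2 / (4 * (1 + ρ))) (1 / (σX * σY * (1 + ρ)))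
        (n * (μX / σX - μY / σY) ^ 2 / (4 * (1 - ρ))) (1 / (σX * σY * (1 - ρ))) (n / 2) x k :=
    fun {x} hx => by
      rw [seriesDensity, ← tsum_mul_left]
      exact tsum_congr (hterm hx)
  refine ⟨fun x hx => ⟨?_, ?_⟩, ?_, ?_, ?_⟩
  · rw [← summable_mul_left_iff (seriesPrefactor_pos hσX hσY hρ μX μY n x).ne']
    simp_rw [hterm hx]
    exact summable_mixSum hl hr hl' hr' ha (hcond.1 hx)
  · rw [hsum hx]
    exact tsum_nonneg (mixSum_nonneg hl hr hl' hr' ha x)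
  · have h := continuousOn_tsum_mixSum hl hr hl' hr' ha
    simp only [← hcond] at h
    exact h.congr fun x hx => hsum hx
  · exact Finset.aemeasurable_fun_sum _ fun i _ => (hident i).aemeasurable_fst
  · rw [map_sum_eq_withDensity hσX hσY hρ hXY hn hident hindep]
    -- The point 0, where the formula is not claimed for n = 1, is a null set.
    refine withDensity_congr_ae ?_
    have h0 : ∀ᵐ x : ℝ, x ≠ 0 := Measure.ae_ne volume 0
    filter_upwards [h0] with x hx
    rw [hsum (Or.inl hx), diffDensity_gammaMixture hl hr hl' hr' ha (Or.inl hx)]
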